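/- **Theorem.** Let $p\ge 0$ be an integer and $n=2p$. (1) Let $M$ be a compact (Hausdorff) oriented smooth manifold without boundary of dimension $n$, and let $H^p(M)$ be its de Rham cohomology in the middle degree $p$ (closed smooth real $p$-forms modulo exact ones). The pairing $$Q([\omega_1],[\omega_2])=\int_M \omega_1\wedge\omega_2$$ does not depend on the closed forms chosen to represent the two classes, and it defines a bilinear form $Q\colon H^p(M)\times H^p(M)\to\mathbb{R}$. It satisfies $Q(b,a)=(-1)^pQ(a,b)$ for all $a,b\in H^p(M)$. Moreover, $Q$ is symmetric if and only if $n=4k$ for some integer $k\ge 0$ or $Q=0$. In particular, if $Q\neq 0$, then $Q$ is symmetric if and only if $n=4k$ for some integer $k$. (2) The form $Q$ is symmetric for every compact oriented smooth manifold without boundary of dimension $n$ if and only if $n=4k$ for some integer $k\ge 0$. -/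

import Mathlib

open scoped Manifold ContDiff
open MeasureTheory

namespace DeRham

/-! ### The wedge product of alternating forms on a vector space -/

section Wedge

variable {V : Type*} [AddCommGroup V] [Module ℝ V] [TopologicalSpace V]

/-- The wedge product of a `p`-form and a `q`-form as an alternating map: the sum over
`(p, q)`-shuffles `σ` of `sign σ • f (v ∘ σ ∘ inl) * g (v ∘ σ ∘ inr)`. -/
noncomputable def wedgeAlt {p q n : ℕ} (h : p + q = n)
    (f : V [⋀^Fin p]→L[ℝ] ℝ) (g : V [⋀^Fin q]→L[ℝ] ℝ) : V [⋀^Fin n]→ₗ[ℝ] ℝ :=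
  ((LinearMap.mul' ℝ ℝ).compAlternatingMap
    (f.toAlternatingMap.domCoprod g.toAlternatingMap)).domDomCongr
      (finSumFinEquiv.trans (finCongr h))

theorem continuous_wedgeAlt {p q n : ℕ} (h : p + q = n)
    (f : V [⋀^Fin p]→L[ℝ] ℝ) (g : V [⋀^Fin q]→L[ℝ] ℝ) : Continuous (wedgeAlt h f g) := by
  have key : ∀ σ : Equiv.Perm.ModSumCongr (Fin p) (Fin q),
      Continuous fun v : Fin n → V => LinearMap.mul' ℝ ℝ
        (AlternatingMap.domCoprod.summand f.toAlternatingMap g.toAlternatingMap σ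
          (v ∘ finCongr h ∘ finSumFinEquiv)) := by
    intro σ
    induction σ using Quotient.inductionOn' with
    | h σ =>
      have : (fun v : Fin n → V => LinearMap.mul' ℝ ℝ
          (AlternatingMap.domCoprod.summand f.toAlternatingMap g.toAlternatingMap
            (Quotient.mk'' σ) (v ∘ finCongr h ∘ finSumFinEquiv))) =
          fun v => ((Equiv.Perm.sign σ : ℤˣ) : ℤ) •
            (f (fun i => v (finCongr h (finSumFinEquiv (σ (Sum.inl i))))) *
              g (fun i => v (finCongr h (finSumFinEquiv (σ (Sum.inr i)))))) := by
        funext v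
        rw [AlternatingMap.domCoprod.summand_mk'', Units.smul_def]
        refine (map_zsmul (LinearMap.mul' ℝ ℝ) _
          (MultilinearMap.domDomCongr σ (f.toAlternatingMap.toMultilinearMap.domCoprod
            g.toAlternatingMap.toMultilinearMap) (v ∘ finCongr h ∘ finSumFinEquiv))).trans ?_
        rfl
      rw [this]
      refine Continuous.fun_const_smul (Continuous.fun_mul ?_ ?_) _
      · exact f.cont.comp (continuous_pi fun i => continuous_apply _)
      · exact g.cont.comp (continuous_pi fun i => continuous_apply _)
  have : (wedgeAlt h f g : (Fin n → V) → ℝ) = fun v => ∑ σ, LinearMap.mul' ℝ ℝ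
        (AlternatingMap.domCoprod.summand f.toAlternatingMap g.toAlternatingMap σ
          (v ∘ finCongr h ∘ finSumFinEquiv)) := by
    funext v
    simp [wedgeAlt, AlternatingMap.domCoprod_apply, map_sum]
  rw [this]
  exact continuous_finsetSum _ fun σ _ => key σ

/-- The wedge product of a `p`-form and a `q`-form on a real topological vector space. The
degree `n` of the result is any natural number equal to `p + q`. -/
noncomputable def wedge {p q n : ℕ} (h : p + q = n)
    (f : V [⋀^Fin p]→L[ℝ] ℝ) (g : V [⋀^Fin q]→L[ℝ] ℝ) : V [⋀^Fin n]→L[ℝ] ℝ :=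
  { wedgeAlt h f g with cont := continuous_wedgeAlt h f g }

end Wedge

/-! ### Differential forms on a smooth manifold -/

variable {n : ℕ} {M : Type*} [TopologicalSpace M] [ChartedSpace (EuclideanSpace ℝ (Fin n)) M]

/-- Not necessarily smooth differential `k`-forms on the `n`-dimensional manifold `M`. -/
def FormField (n : ℕ) (M : Type*) [TopologicalSpace M]
    [ChartedSpace (EuclideanSpace ℝ (Fin n)) M] (k : ℕ) : Type _ :=
  (x : M) → TangentSpace (𝓡 n) x [⋀^Fin k]→L[ℝ] ℝ

noncomputable instance (k : ℕ) : AddCommGroup (FormField n M k) :=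
  inferInstanceAs (AddCommGroup ((x : M) → TangentSpace (𝓡 n) x [⋀^Fin k]→L[ℝ] ℝ))

noncomputable instance (k : ℕ) : Module ℝ (FormField n M k) :=
  inferInstanceAs (Module ℝ ((x : M) → TangentSpace (𝓡 n) x [⋀^Fin k]→L[ℝ] ℝ))

/-- The local expression `(e⁻¹)^* α` of the form `α` in the chart `e`. It is meaningful on
`e.target`. -/
noncomputable def inChart {k : ℕ} (e : OpenPartialHomeomorph M (EuclideanSpace ℝ (Fin n)))
    (α : FormField n M k) :
    EuclideanSpace ℝ (Fin n) → EuclideanSpace ℝ (Fin n) [⋀^Fin k]→L[ℝ] ℝ :=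
  fun y => (α (e.symm y)).compContinuousLinearMap (mfderiv (𝓡 n) (𝓡 n) e.symm y)

theorem inChart_add {k : ℕ} (e : OpenPartialHomeomorph M (EuclideanSpace ℝ (Fin n)))
    (α β : FormField n M k) : inChart e (α + β) = inChart e α + inChart e β := rfl

theorem inChart_smul {k : ℕ} (e : OpenPartialHomeomorph M (EuclideanSpace ℝ (Fin n)))
    (c : ℝ) (α : FormField n M k) : inChart e (c • α) = c • inChart e α := rfl

variable (n M) in
/-- The space `Ω^k(M)` of smooth differential `k`-forms. -/
def Form (k : ℕ) : Submodule ℝ (FormField n M k) where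
  carrier := {α | ∀ e ∈ atlas (EuclideanSpace ℝ (Fin n)) M,
    ContDiffOn ℝ ∞ (inChart e α) e.target}
  add_mem' := fun ha hb e he => (ha e he).add (hb e he)
  zero_mem' := fun e _ => (contDiffOn_const (c := 0) : ContDiffOn ℝ ∞
    (fun _ : EuclideanSpace ℝ (Fin n) => (0 : EuclideanSpace ℝ (Fin n) [⋀^Fin k]→L[ℝ] ℝ)) e.target)
  smul_mem' := fun c _ ha e he => (ha e he).const_smul c

theorem mem_Form {k : ℕ} {α : FormField n M k} : α ∈ Form n M k ↔
    ∀ e ∈ atlas (EuclideanSpace ℝ (Fin n)) M, ContDiffOn ℝ ∞ (inChart e α) e.target := Iff.rfl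

/-- The exterior derivative of a form: at `x` it is the exterior derivative of the local
expression of the form in the preferred chart at `x`, pulled back to `M`. -/
noncomputable def extDerivField {k : ℕ} (α : FormField n M k) : FormField n M (k + 1) :=
  fun x => (extDeriv (inChart (chartAt (EuclideanSpace ℝ (Fin n)) x) α)
    (chartAt (EuclideanSpace ℝ (Fin n)) x x)).compContinuousLinearMap
      (mfderiv (𝓡 n) (𝓡 n) (chartAt (EuclideanSpace ℝ (Fin n)) x) x)

theorem compContinuousLinearMap_congr {k : ℕ} (α : FormField n M k) {x x' : M} (h : x = x')
    {A : EuclideanSpace ℝ (Fin n) →L[ℝ] TangentSpace (𝓡 n) x}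
    {A' : EuclideanSpace ℝ (Fin n) →L[ℝ] TangentSpace (𝓡 n) x'}
    (hA : (A : EuclideanSpace ℝ (Fin n) →L[ℝ] EuclideanSpace ℝ (Fin n)) = A') :
    (α x).compContinuousLinearMap A = (α x').compContinuousLinearMap A' := by
  subst h
  exact congrArg (fun B => (α x).compContinuousLinearMap B) hA

/-- The local expressions of a form in two charts are related by pullback along the transition
map. -/
theorem inChart_transition [IsManifold (𝓡 n) ∞ M] {k : ℕ} (α : FormField n M k)
    {e c : OpenPartialHomeomorph M (EuclideanSpace ℝ (Fin n))}
    (he : e ∈ atlas (EuclideanSpace ℝ (Fin n)) M) (hc : c ∈ atlas (EuclideanSpace ℝ (Fin n)) M)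
    {y : EuclideanSpace ℝ (Fin n)} (hy : y ∈ e.target) (hyc : e.symm y ∈ c.source) :
    inChart e α y = (inChart c α (c (e.symm y))).compContinuousLinearMap
      (fderiv ℝ (c ∘ e.symm) y) := by
  have : IsManifold (𝓡 n) 1 M := IsManifold.of_le (n := ∞) (by simp)
  have h1 : MDifferentiableAt (𝓡 n) (𝓡 n) e.symm y := mdifferentiableAt_atlas_symm he hy
  have h2 : MDifferentiableAt (𝓡 n) (𝓡 n) c (e.symm y) := mdifferentiableAt_atlas hc hyc
  have h3 : MDifferentiableAt (𝓡 n) (𝓡 n) c.symm (c (e.symm y)) :=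
    mdifferentiableAt_atlas_symm hc (c.map_source hyc)
  have h4 : MDifferentiableAt (𝓡 n) (𝓡 n) (c ∘ e.symm) y := h2.comp y h1
  have hev : e.symm =ᶠ[nhds y] c.symm ∘ (c ∘ e.symm) := by
    filter_upwards [(e.symm.continuousAt hy).preimage_mem_nhds (c.open_source.mem_nhds hyc)]
      with z hz
    exact (c.left_inv hz).symm
  have h5 : (mfderiv (𝓡 n) (𝓡 n) e.symm y :
      EuclideanSpace ℝ (Fin n) →L[ℝ] EuclideanSpace ℝ (Fin n)) =
      (mfderiv (𝓡 n) (𝓡 n) c.symm (c (e.symm y)) :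
        EuclideanSpace ℝ (Fin n) →L[ℝ] EuclideanSpace ℝ (Fin n)).comp
      (fderiv ℝ (c ∘ e.symm) y) := by
    have h6 := mfderiv_comp (I := 𝓡 n) (I' := 𝓡 n) (I'' := 𝓡 n) y
      (g := c.symm) (f := c ∘ e.symm) h3 h4
    exact (hev.mfderiv_eq (I := 𝓡 n) (I' := 𝓡 n)).trans
      (h6.trans (congrArg _ mfderiv_eq_fderiv))
  exact compContinuousLinearMap_congr α (c.left_inv hyc).symm h5

theorem inChart_differentiableAt {k : ℕ} {α : FormField n M k} (hα : α ∈ Form n M k)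
    {e : OpenPartialHomeomorph M (EuclideanSpace ℝ (Fin n))}
    (he : e ∈ atlas (EuclideanSpace ℝ (Fin n)) M)
    {y : EuclideanSpace ℝ (Fin n)} (hy : y ∈ e.target) :
    DifferentiableAt ℝ (inChart e α) y :=
  ((mem_Form.1 hα e he).contDiffAt (e.open_target.mem_nhds hy)).differentiableAt (by simp)

/-- In every chart of the atlas, the exterior derivative is the usual one. -/
theorem inChart_extDerivField [IsManifold (𝓡 n) ∞ M] {k : ℕ} {α : FormField n M k}
    (hα : α ∈ Form n M k) {e : OpenPartialHomeomorph M (EuclideanSpace ℝ (Fin n))}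
    (he : e ∈ atlas (EuclideanSpace ℝ (Fin n)) M)
    {y : EuclideanSpace ℝ (Fin n)} (hy : y ∈ e.target) :
    inChart e (extDerivField α) y = extDeriv (inChart e α) y := by
  have : IsManifold (𝓡 n) 1 M := IsManifold.of_le (n := ∞) (by simp)
  have hc := chart_mem_atlas (EuclideanSpace ℝ (Fin n)) (e.symm y)
  have hyc := mem_chart_source (EuclideanSpace ℝ (Fin n)) (e.symm y)
  set c := chartAt (EuclideanSpace ℝ (Fin n)) (e.symm y) with hcdef
  have h1 : MDifferentiableAt (𝓡 n) (𝓡 n) e.symm y := mdifferentiableAt_atlas_symm he hy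
  have h2 : MDifferentiableAt (𝓡 n) (𝓡 n) c (e.symm y) := mdifferentiableAt_atlas hc hyc
  have hcomp : fderiv ℝ (c ∘ e.symm) y =
      (mfderiv (𝓡 n) (𝓡 n) c (e.symm y)).comp (mfderiv (𝓡 n) (𝓡 n) e.symm y) := by
    rw [← mfderiv_eq_fderiv]
    exact mfderiv_comp (I := 𝓡 n) (I' := 𝓡 n) (I'' := 𝓡 n) y (g := c) (f := e.symm) h2 h1
  have hsm : ContDiffAt ℝ ∞ (c ∘ e.symm) y := by
    have := ((contMDiffOn_of_mem_maximalAtlas (I := 𝓡 n) (n := ∞)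
      (IsManifold.subset_maximalAtlas hc)).contMDiffAt (c.open_source.mem_nhds hyc)).comp y
      ((contMDiffOn_symm_of_mem_maximalAtlas (I := 𝓡 n) (n := ∞)
      (IsManifold.subset_maximalAtlas he)).contMDiffAt (e.open_target.mem_nhds hy))
    exact this.contDiffAt
  have hev : inChart e α =ᶠ[nhds y] fun z =>
      (inChart c α ((c ∘ e.symm) z)).compContinuousLinearMap (fderiv ℝ (c ∘ e.symm) z) := by
    filter_upwards [(e.symm.continuousAt hy).preimage_mem_nhds (c.open_source.mem_nhds hyc),
      e.open_target.mem_nhds hy] with z hz hz'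
    exact inChart_transition α he hc hz' hz
  rw [hev.extDeriv_eq, extDeriv_pullback (r := ∞) (f := c ∘ e.symm)
    (inChart_differentiableAt hα hc (c.map_source hyc)) hsm (by
      rw [minSmoothness_of_isRCLikeNormedField]; exact WithTop.coe_le_coe.2 (le_top : (2 : ℕ∞) ≤ ⊤)), hcomp]
  rfl

theorem extDerivField_mem [IsManifold (𝓡 n) ∞ M] {k : ℕ} {α : FormField n M k}
    (hα : α ∈ Form n M k) : extDerivField α ∈ Form n M (k + 1) := by
  refine mem_Form.2 fun e he => ?_
  have h : ContDiffOn ℝ ∞ (extDeriv (inChart e α)) e.target := by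
    have h1 : ContDiffOn ℝ ∞ (fderiv ℝ (inChart e α)) e.target :=
      (mem_Form.1 hα e he).fderiv_of_isOpen e.open_target (by simp)
    exact (ContinuousAlternatingMap.alternatizeUncurryFinCLM ℝ (EuclideanSpace ℝ (Fin n))
      ℝ).contDiff.comp_contDiffOn h1
  exact h.congr fun y hy => inChart_extDerivField hα he hy

variable (n M) in
/-- The exterior derivative `d : Ω^k(M) → Ω^{k+1}(M)`. -/
noncomputable def d [IsManifold (𝓡 n) ∞ M] (k : ℕ) : Form n M k →ₗ[ℝ] Form n M (k + 1) where
  toFun α := ⟨extDerivField α.1, extDerivField_mem α.2⟩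
  map_add' α β := by
    ext1
    funext x
    simp only [extDerivField, Submodule.coe_add, inChart_add]
    rw [extDeriv_add (inChart_differentiableAt α.2 (chart_mem_atlas _ x) (mem_chart_target _ x))
      (inChart_differentiableAt β.2 (chart_mem_atlas _ x) (mem_chart_target _ x))]
    rfl
  map_smul' c α := by
    ext1
    funext x
    simp only [extDerivField, Submodule.coe_smul, inChart_smul]
    rw [extDeriv_smul]
    rfl

variable (n M) in
/-- The space of closed `k`-forms. -/
noncomputable def Closed [IsManifold (𝓡 n) ∞ M] (k : ℕ) : Submodule ℝ (Form n M k) :=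
  LinearMap.ker (d n M k)

variable (n M) in
/-- The space of exact `k`-forms; only zero is exact in degree `0`. -/
noncomputable def Exact [IsManifold (𝓡 n) ∞ M] : (k : ℕ) → Submodule ℝ (Form n M k)
  | 0 => ⊥
  | k + 1 => LinearMap.range (d n M k)

variable (n M) in
/-- The de Rham cohomology space `H^k(M)`: closed forms modulo exact forms. -/
abbrev Cohomology [IsManifold (𝓡 n) ∞ M] (k : ℕ) : Type _ :=
  Closed n M k ⧸ (Exact n M k).submoduleOf (Closed n M k)

/-- The cohomology class of a closed form. -/
noncomputable abbrev cls [IsManifold (𝓡 n) ∞ M] {k : ℕ} (α : Closed n M k) : Cohomology n M k :=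
  Submodule.Quotient.mk α

/-! ### Orientations and integration -/

/-- The frame at the point `e.symm y` of `M` given by the coordinate vector fields of `e`. -/
noncomputable def frame (e : OpenPartialHomeomorph M (EuclideanSpace ℝ (Fin n)))
    (y : EuclideanSpace ℝ (Fin n)) (i : Fin n) : TangentSpace (𝓡 n) (e.symm y) :=
  mfderiv (𝓡 n) (𝓡 n) e.symm y (EuclideanSpace.single i (1 : ℝ))

/-- The sign (`1` or `-1` at points of `e.target`) of the coordinate frame of the chart `e` with
respect to given orientations of the tangent spaces. -/
noncomputable def chartSign (o : (x : M) → Orientation ℝ (TangentSpace (𝓡 n) x) (Fin n))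
    (e : OpenPartialHomeomorph M (EuclideanSpace ℝ (Fin n))) (y : EuclideanSpace ℝ (Fin n)) : ℝ :=
  ((SignType.sign ((o (e.symm y)).someVector (frame e y)) : SignType) : ℝ)

variable (n M) in
/-- An orientation of the manifold `M`: an orientation of each tangent space, varying
continuously, that is, such that the sign of every coordinate frame is locally constant. -/
structure ManifoldOrientation where
  /-- the orientation of the tangent space at each point -/
  at' : (x : M) → Orientation ℝ (TangentSpace (𝓡 n) x) (Fin n)
  locally_constant : ∀ e ∈ atlas (EuclideanSpace ℝ (Fin n)) M, ∀ y ∈ e.target,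
    ∀ᶠ z in nhds y, chartSign at' e z = chartSign at' e y

variable (n M) in
/-- A smooth partition of unity on `M`, subordinate to the cover by the preferred charts. -/
noncomputable def chartPartition [IsManifold (𝓡 n) ∞ M] [T2Space M] [CompactSpace M] :
    SmoothPartitionOfUnity M (𝓡 n) M Set.univ :=
  (SmoothPartitionOfUnity.exists_isSubordinate_chartAt_source (𝓡 n) M).choose

/-- The integral `∫_M α` of an `n`-form over the compact oriented `n`-manifold `M`: the sum over
a partition of unity of the oriented integrals, in charts, of the localized forms. By compactness
only finitely many members of the partition of unity are nonzero. -/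
noncomputable def integral [IsManifold (𝓡 n) ∞ M] [T2Space M] [CompactSpace M]
    (o : ManifoldOrientation n M) (α : FormField n M n) : ℝ :=
  ∑ᶠ i : M, ∫ y in (chartAt (EuclideanSpace ℝ (Fin n)) i).target,
    chartPartition n M i ((chartAt (EuclideanSpace ℝ (Fin n)) i).symm y) *
      (chartSign o.at' (chartAt (EuclideanSpace ℝ (Fin n)) i) y *
        inChart (chartAt (EuclideanSpace ℝ (Fin n)) i) α y
          (fun j => EuclideanSpace.single j (1 : ℝ)))

/-- The pointwise wedge product of differential forms. -/
noncomputable def wedgeField {p q m : ℕ} (h : p + q = m) (α : FormField n M p)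
    (β : FormField n M q) : FormField n M m :=
  fun x => wedge h (α x) (β x)

/-- The bilinear form `Q` on the cohomology of the compact oriented manifold `M` of dimension
`n = p + p` in the middle degree `p` is given by `Q([α₁], [α₂]) = ∫_M α₁ ∧ α₂`, for all closed
`p`-forms `α₁` and `α₂`. -/
def IsSignatureForm [IsManifold (𝓡 n) ∞ M] [T2Space M] [CompactSpace M] {p : ℕ}
    (h : p + p = n) (o : ManifoldOrientation n M)
    (Q : LinearMap.BilinForm ℝ (Cohomology n M p)) : Prop :=
  ∀ α₁ α₂ : Closed n M p, Q (cls α₁) (cls α₂) = integral o (wedgeField h α₁.1.1 α₂.1.1)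

end DeRham

/-!
The pairing of closed forms `(α, β) ↦ ∫ α ∧ β` descends to cohomology because `dη ∧ β = d(η ∧ β)`
for a closed form `β` (`extDeriv_wedge_of_extDeriv_eq_zero`, `inChart_extDerivField_wedgeField`)
and the integral of an exact form over a compact manifold without boundary vanishes
(`integral_extDerivField`). The other argument is covered by graded commutativity of the wedge
product (`wedge_comm`), which also gives `Q b a = (-1) ^ (p * p) * Q a b = (-1) ^ p * Q a b`. So `Q`
is symmetric when `p` is even, and for odd `p` a symmetric `Q` satisfies `Q = -Q`, that is, `Q = 0`.

The identities of multilinear algebra are proved by replacing the sum over shuffles in the wedge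
product by the sum over all permutations (`factorial_mul_wedge_apply`), where they become changes of
the summation variable. Stokes' theorem is reduced by a partition of unity to a form supported in
one chart, where it says that directional derivatives of compactly supported functions integrate to
zero; this uses that the integral of such a form can be computed in that chart alone
(`integral_eq_chartIntegral`), a consequence of the change of variables formula.

That symmetry fails for some manifold when `p` is odd is seen on the torus `(ℝ / ℤ) ^ (2 p)`. Its
charts are the local inverses of the covering map from `ℝ ^ (2 p)`, so that transition maps are
locally translations and the constant forms `dx₁ ∧ … ∧ dx_p` and `dx_{p+1} ∧ … ∧ dx_{2p}` are
well-defined and closed. Their product is the volume form, whose integral is not zero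
(`IsSignatureForm.torus_ne_zero`).
-/

namespace DeRham

/-! ### Algebra of the wedge product -/

section WedgeAlgebra

variable {V : Type*} [AddCommGroup V] [Module ℝ V] [TopologicalSpace V]

/-- The sign of a permutation as a real number. -/
noncomputable def permSign {ι : Type*} [DecidableEq ι] [Fintype ι] (σ : Equiv.Perm ι) : ℝ :=
  ((Equiv.Perm.sign σ : ℤ) : ℝ)

section PermSign

variable {ι κ : Type*} [DecidableEq ι] [Fintype ι] [DecidableEq κ] [Fintype κ]

theorem permSign_mul (σ τ : Equiv.Perm ι) : permSign (σ * τ) = permSign σ * permSign τ := by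
  simp [permSign]

theorem permSign_mul_self (σ : Equiv.Perm ι) : permSign σ * permSign σ = 1 := by
  simp only [permSign]
  rw [← Int.cast_mul, ← Units.val_mul, Int.units_mul_self]
  simp

theorem permSign_inv (σ : Equiv.Perm ι) : permSign σ⁻¹ = permSign σ := by
  simp [permSign]

theorem permSign_permCongr (e : ι ≃ κ) (σ : Equiv.Perm ι) :
    permSign (e.permCongr σ) = permSign σ := by
  simp [permSign]

theorem units_smul_eq_permSign_mul (σ : Equiv.Perm ι) (x : ℝ) :
    Equiv.Perm.sign σ • x = permSign σ * x := by
  rw [Units.smul_def, zsmul_eq_mul, permSign]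

end PermSign

theorem map_perm_eq_permSign_mul {p : ℕ} (f : V [⋀^Fin p]→L[ℝ] ℝ) (v : Fin p → V)
    (σ : Equiv.Perm (Fin p)) : f (fun i => v (σ i)) = permSign σ * f v := by
  rw [← units_smul_eq_permSign_mul]
  exact f.toAlternatingMap.map_perm v σ

/-- Summing over all permutations instead of shuffles counts each term of the wedge product
`p! * q!` times. -/
theorem factorial_mul_wedge_apply {p q n : ℕ} (h : p + q = n)
    (f : V [⋀^Fin p]→L[ℝ] ℝ) (g : V [⋀^Fin q]→L[ℝ] ℝ) (v : Fin n → V) :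
    ((p.factorial : ℝ) * q.factorial) * wedge h f g v = ∑ σ : Equiv.Perm (Fin n), permSign σ *
      (f (fun i => v (σ (Fin.cast h (Fin.castAdd q i)))) *
        g (fun j => v (σ (Fin.cast h (Fin.natAdd p j))))) := by
  subst h
  have key := congrArg (LinearMap.mul' ℝ ℝ) (DFunLike.congr_fun
    (MultilinearMap.domCoprod_alternization_eq f.toAlternatingMap g.toAlternatingMap)
      (v ∘ finSumFinEquiv))
  rw [MultilinearMap.alternatization_apply, map_sum, AlternatingMap.smul_apply, map_nsmul,
    nsmul_eq_mul, Fintype.card_fin, Fintype.card_fin] at key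
  have hw : LinearMap.mul' ℝ ℝ ((f.toAlternatingMap.domCoprod g.toAlternatingMap)
      (v ∘ finSumFinEquiv)) = wedge rfl f g v := rfl
  rw [hw] at key
  push_cast at key
  rw [← key]
  refine Fintype.sum_equiv (finSumFinEquiv (m := p) (n := q)).permCongr _ _ fun σ => ?_
  rw [permSign_permCongr, ← units_smul_eq_permSign_mul]
  refine (map_zsmul (LinearMap.mul' ℝ ℝ) _ _).trans ?_
  rw [Units.smul_def]
  congr 1
  refine (LinearMap.mul'_apply ..).trans ?_
  simp [Equiv.permCongr_apply]

theorem factorial_mul_ne_zero (p q : ℕ) : ((p.factorial : ℝ) * q.factorial) ≠ 0 := by positivity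

theorem wedge_add_left {p q n : ℕ} (h : p + q = n) (f f' : V [⋀^Fin p]→L[ℝ] ℝ)
    (g : V [⋀^Fin q]→L[ℝ] ℝ) : wedge h (f + f') g = wedge h f g + wedge h f' g := by
  ext v
  refine mul_left_cancel₀ (factorial_mul_ne_zero p q) ?_
  rw [ContinuousAlternatingMap.add_apply, mul_add]
  simp only [factorial_mul_wedge_apply, ContinuousAlternatingMap.add_apply,
    ← Finset.sum_add_distrib]
  exact Finset.sum_congr rfl fun σ _ => by ring

theorem wedge_smul_left {p q n : ℕ} (h : p + q = n) (c : ℝ) (f : V [⋀^Fin p]→L[ℝ] ℝ)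
    (g : V [⋀^Fin q]→L[ℝ] ℝ) : wedge h (c • f) g = c • wedge h f g := by
  ext v
  refine mul_left_cancel₀ (factorial_mul_ne_zero p q) ?_
  rw [ContinuousAlternatingMap.smul_apply, smul_eq_mul, mul_left_comm]
  simp only [factorial_mul_wedge_apply, ContinuousAlternatingMap.smul_apply, Finset.mul_sum,
    smul_eq_mul]
  exact Finset.sum_congr rfl fun σ _ => by ring

/-- The rotation of `Fin n` that moves the first `q` indices past the last `p` has sign
`(-1) ^ (p * q)`. -/
theorem permSign_finRotate_pow {p q n : ℕ} (h : p + q = n) :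
    permSign (finRotate n ^ q) = (-1) ^ (p * q) := by
  rw [permSign, map_pow, sign_finRotate, ← pow_mul]
  push_cast
  rcases n with _ | m
  · obtain ⟨rfl, rfl⟩ : p = 0 ∧ q = 0 := by omega
    simp
  · rw [Nat.add_sub_cancel, show ((-1 : ℝ) ^ (m * q)) = (-1) ^ (m * q) * 1 from (mul_one _).symm]
    rcases q with _ | q
    · simp
    have hm : m = p + q := by omega
    -- `q` rotations of sign `(-1) ^ (p + q - 1)` each, and `q * (q - 1)` is even
    have h2 : (-1 : ℝ) ^ (q * (q + 1)) = 1 := (Nat.even_mul_succ_self q).neg_one_pow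
    rw [hm, mul_one, add_mul, pow_add, h2, mul_one]

theorem finRotate_pow_apply_val {n : ℕ} (q : ℕ) (i : Fin n) :
    ((finRotate n ^ q) i : ℕ) = (i + q) % n := by
  induction q with
  | zero => simp [Nat.mod_eq_of_lt i.2]
  | succ q ih =>
    rw [pow_succ', Equiv.Perm.mul_apply]
    rcases n with _ | m
    · exact i.elim0
    · rw [finRotate_apply, Fin.val_add, ih, Fin.val_one', ← Nat.add_mod, add_assoc]

/-- Graded commutativity of the wedge product. -/
theorem wedge_comm {p q n : ℕ} (h : p + q = n) (h' : q + p = n) (f : V [⋀^Fin p]→L[ℝ] ℝ)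
    (g : V [⋀^Fin q]→L[ℝ] ℝ) : wedge h f g = (-1 : ℝ) ^ (p * q) • wedge h' g f := by
  ext v
  refine mul_left_cancel₀ (factorial_mul_ne_zero p q) ?_
  rw [ContinuousAlternatingMap.smul_apply, smul_eq_mul, mul_left_comm, factorial_mul_wedge_apply,
    mul_comm (p.factorial : ℝ), factorial_mul_wedge_apply, Finset.mul_sum]
  symm
  refine Fintype.sum_equiv (Equiv.mulRight (finRotate n ^ q)) _ _ fun σ => ?_
  rw [Equiv.coe_mulRight, permSign_mul, permSign_finRotate_pow h]
  have hl : ∀ i : Fin p, (finRotate n ^ q) (Fin.cast h (Fin.castAdd q i)) =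
      Fin.cast h' (Fin.natAdd q i) := fun i => by
    ext
    rw [finRotate_pow_apply_val]
    simp only [Fin.val_cast, Fin.val_castAdd, Fin.val_natAdd]
    rw [Nat.mod_eq_of_lt (by omega), add_comm]
  have hr : ∀ j : Fin q, (finRotate n ^ q) (Fin.cast h (Fin.natAdd p j)) =
      Fin.cast h' (Fin.castAdd p j) := fun i => by
    ext
    rw [finRotate_pow_apply_val]
    simp only [Fin.val_cast, Fin.val_castAdd, Fin.val_natAdd]
    rw [show p + (i : ℕ) + q = i + n by omega, Nat.add_mod_right, Nat.mod_eq_of_lt (by omega)]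
  simp only [Equiv.Perm.mul_apply, hl, hr]
  ring

theorem wedge_add_right {p q n : ℕ} (h : p + q = n) (f : V [⋀^Fin p]→L[ℝ] ℝ)
    (g g' : V [⋀^Fin q]→L[ℝ] ℝ) : wedge h f (g + g') = wedge h f g + wedge h f g' := by
  have h' : q + p = n := by omega
  rw [wedge_comm h h', wedge_comm h h', wedge_comm h h' f g', wedge_add_left, smul_add]

theorem wedge_smul_right {p q n : ℕ} (h : p + q = n) (c : ℝ) (f : V [⋀^Fin p]→L[ℝ] ℝ)
    (g : V [⋀^Fin q]→L[ℝ] ℝ) : wedge h f (c • g) = c • wedge h f g := by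
  have h' : q + p = n := by omega
  rw [wedge_comm h h', wedge_comm h h', wedge_smul_left, smul_comm]

/-- The wedge product commutes with pullback along a linear map. -/
theorem wedge_compContinuousLinearMap {W : Type*} [AddCommGroup W] [Module ℝ W]
    [TopologicalSpace W] {p q n : ℕ} (h : p + q = n) (f : V [⋀^Fin p]→L[ℝ] ℝ)
    (g : V [⋀^Fin q]→L[ℝ] ℝ) (L : W →L[ℝ] V) :
    (wedge h f g).compContinuousLinearMap L =
      wedge h (f.compContinuousLinearMap L) (g.compContinuousLinearMap L) := by
  ext v
  refine mul_left_cancel₀ (factorial_mul_ne_zero p q) ?_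
  rw [ContinuousAlternatingMap.compContinuousLinearMap_apply, factorial_mul_wedge_apply,
    factorial_mul_wedge_apply]
  rfl

end WedgeAlgebra

section Uncurry

variable {V : Type*} [NormedAddCommGroup V] [NormedSpace ℝ V]

open ContinuousAlternatingMap

/-- `alternatizeUncurryFin` as a sum over all permutations. The left-hand side is alternating, so
it is the average of its signed permutations; in that average each of the `n + 1` terms in the
definition of `alternatizeUncurryFin` contributes the right-hand side, after a cyclic change of
variables. -/
theorem factorial_mul_alternatizeUncurryFin_apply {n : ℕ} (F : V →L[ℝ] V [⋀^Fin n]→L[ℝ] ℝ)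
    (v : Fin (n + 1) → V) :
    (n.factorial : ℝ) * alternatizeUncurryFin F v = ∑ τ : Equiv.Perm (Fin (n + 1)),
      permSign τ * F (v (τ 0)) (fun i => v (τ i.succ)) := by
  have hn : ((n + 1 : ℕ) : ℝ) ≠ 0 := by positivity
  refine mul_left_cancel₀ hn ?_
  set S := ∑ τ : Equiv.Perm (Fin (n + 1)), permSign τ * F (v (τ 0)) (fun i => v (τ i.succ))
  have h1 : ((n + 1).factorial : ℝ) * alternatizeUncurryFin F v =
      ∑ τ : Equiv.Perm (Fin (n + 1)), permSign τ *
        alternatizeUncurryFin F (fun i => v (τ i)) := by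
    simp only [map_perm_eq_permSign_mul, ← mul_assoc, permSign_mul_self, one_mul]
    rw [Finset.sum_const, Finset.card_univ, Fintype.card_perm, Fintype.card_fin, nsmul_eq_mul]
  rw [← mul_assoc, ← Nat.cast_mul, ← Nat.factorial_succ, h1]
  simp only [alternatizeUncurryFin_apply, Finset.mul_sum]
  rw [Finset.sum_comm]
  have h2 : ∀ i : Fin (n + 1), ∑ τ : Equiv.Perm (Fin (n + 1)), permSign τ *
      ((-1) ^ (i : ℕ) • F (v (τ i)) (i.removeNth fun i => v (τ i))) = S := fun i => by
    refine Fintype.sum_equiv (Equiv.mulRight (Fin.cycleRange i)⁻¹) _ _ fun τ => ?_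
    rw [Equiv.coe_mulRight, permSign_mul, permSign_inv, mul_assoc]
    congr 1
    have : permSign (Fin.cycleRange i) = (-1) ^ (i : ℕ) := by simp [permSign, Fin.sign_cycleRange]
    rw [this, zsmul_eq_mul]
    push_cast
    simp only [Function.comp_apply, Equiv.Perm.inv_def,
      Fin.cycleRange_symm_zero, Fin.cycleRange_symm_succ]
    rfl
  rw [Finset.sum_congr rfl fun i _ => h2 i]
  simp

/-- Antisymmetrizing `v ↦ F v ∧ g` gives the antisymmetrization of `F`, wedged with `g`: both are
multiples of the full antisymmetrization of `(v₀, …, vₙ) ↦ F v₀ (v₁, …, v_p) * g (v_{p+1}, …, vₙ)`.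
This is the algebra behind the Leibniz rule. -/
theorem alternatizeUncurryFin_wedge {p q n : ℕ} (h : p + q = n) (h' : p + 1 + q = n + 1)
    (F : V →L[ℝ] V [⋀^Fin p]→L[ℝ] ℝ) (g : V [⋀^Fin q]→L[ℝ] ℝ)
    (G : V →L[ℝ] V [⋀^Fin n]→L[ℝ] ℝ) (hG : ∀ v, G v = wedge h (F v) g) :
    alternatizeUncurryFin G = wedge h' (alternatizeUncurryFin F) g := by
  ext v
  set A : ℝ := ∑ τ : Equiv.Perm (Fin (n + 1)), permSign τ *
    (F (v (τ 0)) (fun i => v (τ (Fin.cast h (Fin.castAdd q i)).succ)) *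
      g (fun j => v (τ (Fin.cast h (Fin.natAdd p j)).succ))) with hA
  have hL : ((p.factorial : ℝ) * q.factorial) * alternatizeUncurryFin G v = A := by
    have hn : (n.factorial : ℝ) ≠ 0 := by positivity
    refine mul_left_cancel₀ hn ?_
    rw [mul_left_comm, factorial_mul_alternatizeUncurryFin_apply, Finset.mul_sum]
    have : ∀ τ : Equiv.Perm (Fin (n + 1)), ((p.factorial : ℝ) * q.factorial) *
        (permSign τ * G (v (τ 0)) fun i => v (τ i.succ)) =
        ∑ σ : Equiv.Perm (Fin n), permSign τ * (permSign σ *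
      (F (v (τ 0)) (fun i => v (τ (σ (Fin.cast h (Fin.castAdd q i))).succ)) *
        g (fun j => v (τ (σ (Fin.cast h (Fin.natAdd p j))).succ)))) := fun τ => by
      rw [mul_left_comm, hG, factorial_mul_wedge_apply, Finset.mul_sum]
    rw [Finset.sum_congr rfl fun τ _ => this τ, Finset.sum_comm]
    -- a permutation `σ` of the last `n` indices is absorbed into `τ`
    have h3 : ∀ σ : Equiv.Perm (Fin n), ∑ τ : Equiv.Perm (Fin (n + 1)),
        permSign τ * (permSign σ *
      (F (v (τ 0)) (fun i => v (τ (σ (Fin.cast h (Fin.castAdd q i))).succ)) *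
        g (fun j => v (τ (σ (Fin.cast h (Fin.natAdd p j))).succ)))) = A := fun σ => by
      refine Fintype.sum_equiv (Equiv.mulRight (Equiv.Perm.decomposeFin.symm (0, σ))) _ _
        fun τ => ?_
      have hs : permSign (Equiv.Perm.decomposeFin.symm (0, σ)) = permSign σ := by
        simp [permSign]
      rw [Equiv.coe_mulRight, permSign_mul, hs, mul_assoc]
      simp [Equiv.Perm.mul_apply]
    rw [Finset.sum_congr rfl fun σ _ => h3 σ, Finset.sum_const, Finset.card_univ,
      Fintype.card_perm, Fintype.card_fin, nsmul_eq_mul]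
  have hR : ((p.factorial : ℝ) * q.factorial) * wedge h' (alternatizeUncurryFin F) g v = A := by
    have hn : ((p + 1).factorial : ℝ) ≠ 0 := by positivity
    have h0 : (0 : Fin (n + 1)) = Fin.cast h' (Fin.castAdd q 0) := rfl
    have h1 : ∀ i : Fin p, (Fin.cast h (Fin.castAdd q i)).succ =
        Fin.cast h' (Fin.castAdd q i.succ) := fun i => rfl
    have h2 : ∀ j : Fin q, (Fin.cast h (Fin.natAdd p j)).succ =
        Fin.cast h' (Fin.natAdd (p + 1) j) := fun j => by
      ext
      simp only [Fin.val_succ, Fin.val_cast, Fin.val_natAdd]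
      omega
    refine mul_left_cancel₀ hn ?_
    rw [show ((p + 1).factorial : ℝ) * ((p.factorial : ℝ) * q.factorial *
        wedge h' (alternatizeUncurryFin F) g v) = p.factorial * (((p + 1).factorial : ℝ) *
          q.factorial * wedge h' (alternatizeUncurryFin F) g v) by ring,
      factorial_mul_wedge_apply, Finset.mul_sum]
    have h3 : ∀ τ : Equiv.Perm (Fin (n + 1)), (p.factorial : ℝ) * (permSign τ *
        (alternatizeUncurryFin F (fun i => v (τ (Fin.cast h' (Fin.castAdd q i)))) *
          g (fun j => v (τ (Fin.cast h' (Fin.natAdd (p + 1) j)))))) =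
        ∑ ρ : Equiv.Perm (Fin (p + 1)), permSign τ * (permSign ρ *
          (F (v (τ (Fin.cast h' (Fin.castAdd q (ρ 0)))))
            (fun i => v (τ (Fin.cast h' (Fin.castAdd q (ρ i.succ))))) *
          g (fun j => v (τ (Fin.cast h' (Fin.natAdd (p + 1) j)))))) := fun τ => by
      rw [mul_left_comm, ← mul_assoc (p.factorial : ℝ),
        factorial_mul_alternatizeUncurryFin_apply, Finset.sum_mul, Finset.mul_sum]
      exact Finset.sum_congr rfl fun ρ _ => by ring
    rw [Finset.sum_congr rfl fun τ _ => h3 τ, Finset.sum_comm]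
    have h4 : ∀ ρ : Equiv.Perm (Fin (p + 1)), ∑ τ : Equiv.Perm (Fin (n + 1)),
        permSign τ * (permSign ρ * (F (v (τ (Fin.cast h' (Fin.castAdd q (ρ 0)))))
            (fun i => v (τ (Fin.cast h' (Fin.castAdd q (ρ i.succ))))) *
          g (fun j => v (τ (Fin.cast h' (Fin.natAdd (p + 1) j)))))) = A := fun ρ => by
      -- extend `ρ` by the identity on the last `q` indices
      set e : Fin (p + 1) ⊕ Fin q ≃ Fin (n + 1) := finSumFinEquiv.trans (finCongr h') with he
      set ρ' : Equiv.Perm (Fin (n + 1)) := e.permCongr (Equiv.sumCongr ρ (Equiv.refl _)) with hρ'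
      have hs : permSign ρ' = permSign ρ := by
        rw [hρ', permSign_permCongr]
        simp [permSign, Equiv.Perm.sign_sumCongr]
      have hinl : ∀ i, e (Sum.inl i) = Fin.cast h' (Fin.castAdd q i) := fun i => by simp [he]
      have hinr : ∀ i, e (Sum.inr i) = Fin.cast h' (Fin.natAdd (p + 1) i) := fun i => by
        simp [he]
      refine Fintype.sum_equiv (Equiv.mulRight ρ') _ _ fun τ => ?_
      rw [Equiv.coe_mulRight, permSign_mul, hs, mul_assoc]
      simp only [h0, h1, h2, ← hinl, ← hinr, hρ', Equiv.Perm.mul_apply, Equiv.permCongr_apply,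
        Equiv.symm_apply_apply, Equiv.sumCongr_apply, Sum.map_inl, Sum.map_inr, Equiv.refl_apply]
    rw [Finset.sum_congr rfl fun ρ _ => h4 ρ, Finset.sum_const, Finset.card_univ,
      Fintype.card_perm, Fintype.card_fin, nsmul_eq_mul]
  exact mul_left_cancel₀ (factorial_mul_ne_zero p q) (hL.trans hR.symm)

end Uncurry

/-! ### Wedge products of differential forms -/

section WedgeCalculus

variable {V : Type*} [NormedAddCommGroup V] [NormedSpace ℝ V] [FiniteDimensional ℝ V]

theorem finiteDimensional_continuousAlternatingMap (k : ℕ) :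
    FiniteDimensional ℝ (V [⋀^Fin k]→L[ℝ] ℝ) := by
  refine FiniteDimensional.of_injective ((AlternatingMap.toMultilinearMapLM (S := ℝ)).comp
    (ContinuousAlternatingMap.toAlternatingMapLinear (R := ℝ) (A := ℝ) (M := V) (N := ℝ)
      (ι := Fin k))) ?_
  intro f g h
  exact ContinuousAlternatingMap.toAlternatingMap_injective
    (AlternatingMap.coe_multilinearMap_injective h)

/-- On a finite-dimensional space the wedge product is a continuous bilinear map. -/
theorem exists_continuousLinearMap_eq_wedge {p q n : ℕ} (h : p + q = n) :
    ∃ B : (V [⋀^Fin p]→L[ℝ] ℝ) →L[ℝ] (V [⋀^Fin q]→L[ℝ] ℝ) →L[ℝ] (V [⋀^Fin n]→L[ℝ] ℝ),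
      ∀ f g, B f g = wedge h f g := by
  have := finiteDimensional_continuousAlternatingMap (V := V) p
  have := finiteDimensional_continuousAlternatingMap (V := V) q
  exact ⟨(LinearMap.mk₂ ℝ (fun f g => wedge h f g) (wedge_add_left h) (wedge_smul_left h)
    (wedge_add_right h) (wedge_smul_right h)).toContinuousBilinearMap, fun f g => rfl⟩

theorem _root_.ContDiffOn.wedge {W : Type*} [NormedAddCommGroup W] [NormedSpace ℝ W] {p q n : ℕ}
    (h : p + q = n) {a : W → V [⋀^Fin p]→L[ℝ] ℝ} {b : W → V [⋀^Fin q]→L[ℝ] ℝ} {s : Set W}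
    {r : WithTop ℕ∞} (ha : ContDiffOn ℝ r a s) (hb : ContDiffOn ℝ r b s) :
    ContDiffOn ℝ r (fun y => DeRham.wedge h (a y) (b y)) s := by
  obtain ⟨B, hB⟩ := exists_continuousLinearMap_eq_wedge (V := V) h
  simp only [← hB]
  exact B.isBoundedBilinearMap.contDiff.comp_contDiffOn (ha.prodMk hb)

/-- The Leibniz rule `d (a ∧ b) = d a ∧ b` when `d b = 0`. The term `a ∧ d b` is dealt with by
graded commutativity. -/
theorem extDeriv_wedge_of_extDeriv_eq_zero {p q n : ℕ} (h : p + q = n) (h' : p + 1 + q = n + 1)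
    {a : V → V [⋀^Fin p]→L[ℝ] ℝ} {b : V → V [⋀^Fin q]→L[ℝ] ℝ} {y : V}
    (ha : DifferentiableAt ℝ a y) (hb : DifferentiableAt ℝ b y) (hb0 : extDeriv b y = 0) :
    extDeriv (fun z => wedge h (a z) (b z)) y = wedge h' (extDeriv a y) (b y) := by
  obtain ⟨B, hB⟩ := exists_continuousLinearMap_eq_wedge (V := V) h
  have hd := (B.hasFDerivAt_of_bilinear ha.hasFDerivAt hb.hasFDerivAt).fderiv
  simp only [← hB]
  rw [extDeriv, hd, ContinuousAlternatingMap.alternatizeUncurryFin_add]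
  have h1 : ContinuousAlternatingMap.alternatizeUncurryFin
      (B.precompL V (fderiv ℝ a y) (b y)) = wedge h' (extDeriv a y) (b y) :=
    alternatizeUncurryFin_wedge h h' (fderiv ℝ a y) (b y) _ fun v => by
      rw [← hB]; simp
  have h2 : ContinuousAlternatingMap.alternatizeUncurryFin
      (B.precompR V (a y) (fderiv ℝ b y)) = 0 := by
    have hqp : q + p = n := by omega
    rw [alternatizeUncurryFin_wedge hqp (by omega) ((-1 : ℝ) ^ (p * q) • fderiv ℝ b y) (a y) _
      fun v => ?_, ContinuousAlternatingMap.alternatizeUncurryFin_smul]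
    · change wedge _ (_ • extDeriv b y) _ = 0
      rw [hb0, wedge_smul_left]
      have h0 := wedge_smul_left (show q + 1 + p = n + 1 by omega) 0
        (0 : V [⋀^Fin (q + 1)]→L[ℝ] ℝ) (a y)
      rw [zero_smul, zero_smul] at h0
      rw [h0, smul_zero]
    · rw [smul_apply, wedge_smul_left, ← wedge_comm h, ← hB]
      simp
  rw [h1, h2, zero_add]

end WedgeCalculus

variable {n : ℕ} {M : Type*} [TopologicalSpace M] [ChartedSpace (EuclideanSpace ℝ (Fin n)) M]

theorem inChart_wedgeField {p q m : ℕ} (h : p + q = m)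
    (e : OpenPartialHomeomorph M (EuclideanSpace ℝ (Fin n))) (α : FormField n M p)
    (β : FormField n M q) (y : EuclideanSpace ℝ (Fin n)) :
    inChart e (wedgeField h α β) y = wedge h (inChart e α y) (inChart e β y) :=
  wedge_compContinuousLinearMap (V := TangentSpace (𝓡 n) (e.symm y)) h (α (e.symm y))
    (β (e.symm y)) _

theorem wedgeField_mem {p q m : ℕ} (h : p + q = m) {α : FormField n M p} {β : FormField n M q}
    (hα : α ∈ Form n M p) (hβ : β ∈ Form n M q) : wedgeField h α β ∈ Form n M m :=
  mem_Form.2 fun e he => ((mem_Form.1 hα e he).wedge h (mem_Form.1 hβ e he)).congr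
    fun y _ => inChart_wedgeField h e α β y

theorem wedgeField_add_left {p q m : ℕ} (h : p + q = m) (α α' : FormField n M p)
    (β : FormField n M q) : wedgeField h (α + α') β = wedgeField h α β + wedgeField h α' β :=
  funext fun x => wedge_add_left (V := TangentSpace (𝓡 n) x) h (α x) (α' x) (β x)

theorem wedgeField_smul_left {p q m : ℕ} (h : p + q = m) (c : ℝ) (α : FormField n M p)
    (β : FormField n M q) : wedgeField h (c • α) β = c • wedgeField h α β :=
  funext fun x => wedge_smul_left (V := TangentSpace (𝓡 n) x) h c (α x) (β x)

theorem wedgeField_comm {p q m : ℕ} (h : p + q = m) (h' : q + p = m) (α : FormField n M p)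
    (β : FormField n M q) : wedgeField h α β = (-1 : ℝ) ^ (p * q) • wedgeField h' β α :=
  funext fun x => wedge_comm (V := TangentSpace (𝓡 n) x) h h' (α x) (β x)

/-- In a chart, `d (α ∧ β) = d α ∧ β` for a closed form `β`. -/
theorem inChart_extDerivField_wedgeField [IsManifold (𝓡 n) ∞ M] {p q m : ℕ} (h : p + q = m)
    (h' : p + 1 + q = m + 1) {α : FormField n M p} {β : FormField n M q}
    (hα : α ∈ Form n M p) (hβ : β ∈ Form n M q) (hβ0 : extDerivField β = 0)
    {e : OpenPartialHomeomorph M (EuclideanSpace ℝ (Fin n))}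
    (he : e ∈ atlas (EuclideanSpace ℝ (Fin n)) M)
    {y : EuclideanSpace ℝ (Fin n)} (hy : y ∈ e.target) :
    inChart e (extDerivField (wedgeField h α β)) y =
      inChart e (wedgeField h' (extDerivField α) β) y := by
  have hb0 : extDeriv (inChart e β) y = 0 := by
    rw [← inChart_extDerivField hβ he hy, hβ0]
    rfl
  rw [inChart_extDerivField (wedgeField_mem h hα hβ) he hy, inChart_wedgeField,
    inChart_extDerivField hα he hy, ← extDeriv_wedge_of_extDeriv_eq_zero h h'
      (inChart_differentiableAt hα he hy) (inChart_differentiableAt hβ he hy) hb0]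
  congr 1
  funext z
  exact inChart_wedgeField h e α β z

/-! ### Localizing forms -/

/-- The product of a function and a form. -/
noncomputable def funSMul {k : ℕ} (ρ : M → ℝ) (α : FormField n M k) : FormField n M k := fun x => ρ x • α x

theorem inChart_funSMul {k : ℕ} (e : OpenPartialHomeomorph M (EuclideanSpace ℝ (Fin n)))
    (ρ : M → ℝ) (α : FormField n M k) (y : EuclideanSpace ℝ (Fin n)) :
    inChart e (funSMul ρ α) y = ρ (e.symm y) • inChart e α y := rfl

theorem funSMul_mem [IsManifold (𝓡 n) ∞ M] {k : ℕ} {ρ : M → ℝ} (hρ : ContMDiff (𝓡 n) 𝓘(ℝ) ∞ ρ)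
    {α : FormField n M k} (hα : α ∈ Form n M k) : funSMul ρ α ∈ Form n M k := by
  refine mem_Form.2 fun e he => ?_
  have h1 : ContDiffOn ℝ ∞ (ρ ∘ e.symm) e.target :=
    (hρ.comp_contMDiffOn (contMDiffOn_symm_of_mem_maximalAtlas (I := 𝓡 n) (n := ∞)
      (IsManifold.subset_maximalAtlas he))).contDiffOn
  exact (h1.smul (mem_Form.1 hα e he)).congr fun y _ => inChart_funSMul e ρ α y

theorem inChart_eq_zero {k : ℕ} (e : OpenPartialHomeomorph M (EuclideanSpace ℝ (Fin n)))
    {α : FormField n M k} {y : EuclideanSpace ℝ (Fin n)} (h : α (e.symm y) = 0) :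
    inChart e α y = 0 := by
  rw [inChart, h]
  rfl

/-! ### Integration in charts -/

section Density

variable {n : ℕ} {M : Type*} [TopologicalSpace M] [ChartedSpace (EuclideanSpace ℝ (Fin n)) M]

/-- The value of a field of top-degree alternating maps on coordinate frames is multiplied by the
Jacobian determinant under a change of chart. It is applied both to forms and to the alternating
maps representing an orientation. -/
theorem frame_eq_det_mul [IsManifold (𝓡 n) ∞ M]
    (φ : (x : M) → TangentSpace (𝓡 n) x [⋀^Fin n]→ₗ[ℝ] ℝ)
    {e c : OpenPartialHomeomorph M (EuclideanSpace ℝ (Fin n))}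
    (he : e ∈ atlas (EuclideanSpace ℝ (Fin n)) M) (hc : c ∈ atlas (EuclideanSpace ℝ (Fin n)) M)
    {y : EuclideanSpace ℝ (Fin n)} (hy : y ∈ e.target) (hyc : e.symm y ∈ c.source) :
    φ (e.symm y) (frame e y) = (fderiv ℝ (c ∘ e.symm) y).det *
      φ (c.symm (c (e.symm y))) (frame c (c (e.symm y))) := by
  have : IsManifold (𝓡 n) 1 M := IsManifold.of_le (n := ∞) (by simp)
  have h1 : MDifferentiableAt (𝓡 n) (𝓡 n) e.symm y := mdifferentiableAt_atlas_symm he hy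
  have h2 : MDifferentiableAt (𝓡 n) (𝓡 n) c (e.symm y) := mdifferentiableAt_atlas hc hyc
  have h3 : MDifferentiableAt (𝓡 n) (𝓡 n) c.symm (c (e.symm y)) :=
    mdifferentiableAt_atlas_symm hc (c.map_source hyc)
  have hev : e.symm =ᶠ[nhds y] c.symm ∘ (c ∘ e.symm) := by
    filter_upwards [(e.symm.continuousAt hy).preimage_mem_nhds (c.open_source.mem_nhds hyc)]
      with z hz
    exact (c.left_inv hz).symm
  have h5 : (mfderiv (𝓡 n) (𝓡 n) e.symm y :
      EuclideanSpace ℝ (Fin n) →L[ℝ] EuclideanSpace ℝ (Fin n)) =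
      (mfderiv (𝓡 n) (𝓡 n) c.symm (c (e.symm y)) :
        EuclideanSpace ℝ (Fin n) →L[ℝ] EuclideanSpace ℝ (Fin n)).comp
      (fderiv ℝ (c ∘ e.symm) y) :=
    (hev.mfderiv_eq (I := 𝓡 n) (I' := 𝓡 n)).trans
      ((mfderiv_comp (I := 𝓡 n) (I' := 𝓡 n) (I'' := 𝓡 n) y
        (g := c.symm) (f := c ∘ e.symm) h3 (h2.comp y h1)).trans
          (congrArg _ mfderiv_eq_fderiv))
  -- the tangent spaces at the two names of the point agree definitionally with the model space
  let ψ : M → EuclideanSpace ℝ (Fin n) [⋀^Fin n]→ₗ[ℝ] ℝ := fun x => φ x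
  let L : EuclideanSpace ℝ (Fin n) →L[ℝ] EuclideanSpace ℝ (Fin n) :=
    mfderiv (𝓡 n) (𝓡 n) c.symm (c (e.symm y))
  let b := (EuclideanSpace.basisFun (Fin n) ℝ).toBasis
  have hb : ∀ i, b i = EuclideanSpace.single i (1 : ℝ) := fun i => by simp [b]
  set D := fderiv ℝ (c ∘ e.symm) y
  have key : ψ (e.symm y) (fun i => L (D (b i))) =
      D.det * ψ (e.symm y) (fun i => L (b i)) := by
    have h6 := congrArg (fun f => f (fun i => D (b i)))
      (AlternatingMap.eq_smul_basis_det b ((ψ (e.symm y)).compLinearMap L.toLinearMap))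
    simp only [AlternatingMap.smul_apply, smul_eq_mul] at h6
    have h7 : b.det (fun i => D (b i)) = D.det := by
      have := b.det_comp D.toLinearMap b
      rw [b.det_self, mul_one] at this
      exact this
    rw [h7, mul_comm] at h6
    exact h6
  have hl : φ (e.symm y) (frame e y) = ψ (e.symm y) (fun i => L (D (b i))) := by
    refine congrArg (ψ (e.symm y)) (funext fun i => ?_)
    rw [hb]
    exact congrArg (fun A : EuclideanSpace ℝ (Fin n) →L[ℝ] EuclideanSpace ℝ (Fin n) =>
      A (EuclideanSpace.single i (1 : ℝ))) h5
  have hr : φ (c.symm (c (e.symm y))) (frame c (c (e.symm y))) =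
      ψ (e.symm y) (fun i => L (b i)) := by
    refine (congrArg (fun x => ψ x (frame c (c (e.symm y)))) (c.left_inv hyc)).trans ?_
    refine congrArg (ψ (e.symm y)) (funext fun i => ?_)
    rw [hb]
    rfl
  rw [hl, hr, key]

/-- The density that is integrated in the chart `e`: the coefficient of the top form `α`,
corrected by the sign of the chart. -/
noncomputable def density (o : ManifoldOrientation n M)
    (e : OpenPartialHomeomorph M (EuclideanSpace ℝ (Fin n))) (α : FormField n M n)
    (y : EuclideanSpace ℝ (Fin n)) : ℝ :=
  chartSign o.at' e y * inChart e α y (fun j => EuclideanSpace.single j (1 : ℝ))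

/-- The sign of the Jacobian determinant cancels between the form and the orientation, which leaves
the absolute value that occurs in the change of variables formula. -/
theorem density_transition [IsManifold (𝓡 n) ∞ M] (o : ManifoldOrientation n M)
    (α : FormField n M n) {e c : OpenPartialHomeomorph M (EuclideanSpace ℝ (Fin n))}
    (he : e ∈ atlas (EuclideanSpace ℝ (Fin n)) M) (hc : c ∈ atlas (EuclideanSpace ℝ (Fin n)) M)
    {y : EuclideanSpace ℝ (Fin n)} (hy : y ∈ e.target) (hyc : e.symm y ∈ c.source) :
    density o e α y = |(fderiv ℝ (c ∘ e.symm) y).det| * density o c α (c (e.symm y)) := by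
  have h1 := frame_eq_det_mul (fun x => (o.at' x).someVector) he hc hy hyc
  have h2 : inChart e α y (fun j => EuclideanSpace.single j (1 : ℝ)) =
      (fderiv ℝ (c ∘ e.symm) y).det *
        inChart c α (c (e.symm y)) (fun j => EuclideanSpace.single j (1 : ℝ)) :=
    frame_eq_det_mul (fun x => (α x).toAlternatingMap) he hc hy hyc
  simp only [density, chartSign]
  rw [h1, h2, sign_mul, SignType.coe_mul, ← sign_mul_self ((fderiv ℝ (c ∘ e.symm) y).det)]
  ring

theorem density_add (o : ManifoldOrientation n M)
    (e : OpenPartialHomeomorph M (EuclideanSpace ℝ (Fin n))) (α β : FormField n M n)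
    (y : EuclideanSpace ℝ (Fin n)) :
    density o e (α + β) y = density o e α y + density o e β y :=
  mul_add _ _ _

theorem density_smul (o : ManifoldOrientation n M)
    (e : OpenPartialHomeomorph M (EuclideanSpace ℝ (Fin n))) (c : ℝ) (α : FormField n M n)
    (y : EuclideanSpace ℝ (Fin n)) :
    density o e (c • α) y = c * density o e α y :=
  mul_left_comm _ _ _

theorem density_funSMul (o : ManifoldOrientation n M)
    (e : OpenPartialHomeomorph M (EuclideanSpace ℝ (Fin n))) (ρ : M → ℝ) (α : FormField n M n)
    (y : EuclideanSpace ℝ (Fin n)) :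
    density o e (funSMul ρ α) y = ρ (e.symm y) * density o e α y :=
  mul_left_comm _ _ _

theorem density_eq_zero (o : ManifoldOrientation n M)
    (e : OpenPartialHomeomorph M (EuclideanSpace ℝ (Fin n))) {α : FormField n M n}
    {y : EuclideanSpace ℝ (Fin n)} (h : α (e.symm y) = 0) : density o e α y = 0 := by
  rw [density, inChart_eq_zero e h]
  exact mul_zero _

theorem continuousOn_density (o : ManifoldOrientation n M)
    {e : OpenPartialHomeomorph M (EuclideanSpace ℝ (Fin n))}
    (he : e ∈ atlas (EuclideanSpace ℝ (Fin n)) M) {α : FormField n M n} (hα : α ∈ Form n M n) :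
    ContinuousOn (density o e α) e.target := by
  refine ContinuousOn.mul (fun y hy => ?_) ?_
  · exact ((continuousAt_const (y := chartSign o.at' e y)).congr
      ((o.locally_constant e he y hy).mono fun z hz => hz.symm)).continuousWithinAt
  · exact (ContinuousAlternatingMap.apply ℝ (EuclideanSpace ℝ (Fin n)) ℝ
      (fun j => EuclideanSpace.single j (1 : ℝ))).continuous.comp_continuousOn
        (mem_Form.1 hα e he).continuousOn

/-- The oriented integral of a top form over the domain of a chart. -/
noncomputable def chartIntegral (o : ManifoldOrientation n M)
    (e : OpenPartialHomeomorph M (EuclideanSpace ℝ (Fin n))) (α : FormField n M n) : ℝ :=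
  ∫ y in e.target, density o e α y

/-- The integral of a form supported in the domains of two charts can be computed in either. -/
theorem chartIntegral_eq_of_support [IsManifold (𝓡 n) ∞ M] (o : ManifoldOrientation n M)
    (α : FormField n M n) {e c : OpenPartialHomeomorph M (EuclideanSpace ℝ (Fin n))}
    (he : e ∈ atlas (EuclideanSpace ℝ (Fin n)) M) (hc : c ∈ atlas (EuclideanSpace ℝ (Fin n)) M)
    (hαe : ∀ x ∉ e.source, α x = 0) (hαc : ∀ x ∉ c.source, α x = 0) :
    chartIntegral o e α = chartIntegral o c α := by
  have hres : ∀ {e c : OpenPartialHomeomorph M (EuclideanSpace ℝ (Fin n))},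
      (∀ x ∉ c.source, α x = 0) →
      ∫ y in (e.symm.trans c).source, density o e α y = chartIntegral o e α := by
    intro e c h
    have hsrc : (e.symm.trans c).source = e.target ∩ e.symm ⁻¹' c.source := by
      rw [OpenPartialHomeomorph.trans_source, e.symm_source]
    rw [hsrc]
    exact (setIntegral_eq_of_subset_of_forall_sdiff_eq_zero e.open_target.measurableSet
      Set.inter_subset_left fun y hy => density_eq_zero o e (h _ fun hyc =>
        hy.2 ⟨hy.1, hyc⟩)).symm
  rw [← hres hαc, ← hres hαe]
  have him : (c.symm.trans e).source = (c ∘ e.symm) '' (e.symm.trans c).source := by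
    have := (e.symm.trans c).image_source_eq_target
    rw [OpenPartialHomeomorph.coe_trans] at this
    rw [this]
    ext z
    simp
  rw [him, integral_image_eq_integral_abs_det_fderiv_smul volume
    (e.symm.trans c).open_source.measurableSet (f' := fderiv ℝ (c ∘ e.symm))]
  · refine setIntegral_congr_fun (e.symm.trans c).open_source.measurableSet fun y hy => ?_
    rw [OpenPartialHomeomorph.trans_source] at hy
    exact density_transition o α he hc (by simpa using hy.1) hy.2
  · intro y hy
    rw [OpenPartialHomeomorph.trans_source] at hy
    have hye : y ∈ e.target := by simpa using hy.1
    have hyc : e.symm y ∈ c.source := hy.2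
    have := ((contMDiffOn_of_mem_maximalAtlas (I := 𝓡 n) (n := ∞)
      (IsManifold.subset_maximalAtlas hc)).contMDiffAt (c.open_source.mem_nhds hyc)).comp y
      ((contMDiffOn_symm_of_mem_maximalAtlas (I := 𝓡 n) (n := ∞)
      (IsManifold.subset_maximalAtlas he)).contMDiffAt (e.open_target.mem_nhds hye))
    exact (this.contDiffAt.differentiableAt (by simp)).hasFDerivAt.hasFDerivWithinAt
  · have := (e.symm.trans c).injOn
    rwa [OpenPartialHomeomorph.coe_trans] at this

/-- A smooth top form with compact support in the domain of the chart `e` has an integrable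
density in `e`. -/
theorem integrableOn_density (o : ManifoldOrientation n M)
    {e : OpenPartialHomeomorph M (EuclideanSpace ℝ (Fin n))}
    (he : e ∈ atlas (EuclideanSpace ℝ (Fin n)) M) {α : FormField n M n} (hα : α ∈ Form n M n)
    {K : Set M} (hK : IsCompact K) (hKe : K ⊆ e.source) (hαK : ∀ x ∉ K, α x = 0) :
    IntegrableOn (density o e α) e.target := by
  have hK' : IsCompact (e '' K) := hK.image_of_continuousOn (e.continuousOn.mono hKe)
  have hsub : e '' K ⊆ e.target := by
    rintro _ ⟨x, hx, rfl⟩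
    exact e.map_source (hKe hx)
  refine (((continuousOn_density o he hα).mono hsub).integrableOn_compact hK'
    ).of_forall_sdiff_eq_zero e.open_target.measurableSet fun y hy => ?_
  exact density_eq_zero o e (hαK _ fun h => hy.2 ⟨_, h, e.right_inv hy.1⟩)

end Density

/-! ### Integration over compact manifolds -/

section Integral

variable {n : ℕ} {M : Type*} [TopologicalSpace M] [ChartedSpace (EuclideanSpace ℝ (Fin n)) M]
  [IsManifold (𝓡 n) ∞ M] [T2Space M] [CompactSpace M]

theorem tsupport_chartPartition_subset (i : M) : tsupport (chartPartition n M i) ⊆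
    (chartAt (EuclideanSpace ℝ (Fin n)) i).source :=
  (SmoothPartitionOfUnity.exists_isSubordinate_chartAt_source (𝓡 n) M).choose_spec i

variable (n M) in
/-- The finitely many indices at which `chartPartition n M` is not identically zero. -/
noncomputable def partitionIndices : Finset M :=
  ((chartPartition n M).locallyFinite.finite_nonempty_of_compact).toFinset

theorem chartPartition_apply_eq_zero {i : M} (hi : i ∉ partitionIndices n M) (x : M) :
    chartPartition n M i x = 0 := by
  by_contra h
  exact hi ((Set.Finite.mem_toFinset _).2 ⟨x, h⟩)

theorem sum_chartPartition (x : M) :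
    ∑ i ∈ partitionIndices n M, chartPartition n M i x = 1 := by
  rw [← (chartPartition n M).sum_eq_one (Set.mem_univ x)]
  refine (finsum_eq_sum_of_support_subset _ fun i hi => ?_).symm
  by_contra h
  exact hi (chartPartition_apply_eq_zero h x)

theorem sum_funSMul_chartPartition {k : ℕ} (α : FormField n M k) :
    ∑ i ∈ partitionIndices n M, funSMul (chartPartition n M i) α = α := by
  funext x
  refine (Finset.sum_apply x (partitionIndices n M)
    (fun i => (funSMul (chartPartition n M i) α :
      (x : M) → TangentSpace (𝓡 n) x [⋀^Fin k]→L[ℝ] ℝ))).trans ?_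
  change ∑ i ∈ _, chartPartition n M i x • α x = α x
  rw [← Finset.sum_smul, sum_chartPartition, one_smul]

theorem funSMul_chartPartition_mem {k : ℕ} {α : FormField n M k} (hα : α ∈ Form n M k) (i : M) :
    funSMul (chartPartition n M i) α ∈ Form n M k :=
  funSMul_mem (chartPartition n M i).contMDiff hα

theorem funSMul_chartPartition_eq_zero {k : ℕ} (α : FormField n M k) {i x : M}
    (hx : x ∉ tsupport (chartPartition n M i)) : funSMul (chartPartition n M i) α x = 0 := by
  rw [funSMul, image_eq_zero_of_notMem_tsupport hx, zero_smul]

theorem isCompact_tsupport_chartPartition (i : M) :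
    IsCompact (tsupport (chartPartition n M i)) := (isClosed_tsupport _).isCompact

variable (o : ManifoldOrientation n M)

theorem integral_eq_sum (α : FormField n M n) : integral o α = ∑ i ∈ partitionIndices n M,
    chartIntegral o (chartAt (EuclideanSpace ℝ (Fin n)) i) (funSMul (chartPartition n M i) α) := by
  rw [integral]
  have h : ∀ i : M, ∫ y in (chartAt (EuclideanSpace ℝ (Fin n)) i).target,
      chartPartition n M i ((chartAt (EuclideanSpace ℝ (Fin n)) i).symm y) *
        (chartSign o.at' (chartAt (EuclideanSpace ℝ (Fin n)) i) y *
          inChart (chartAt (EuclideanSpace ℝ (Fin n)) i) α y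
            (fun j => EuclideanSpace.single j (1 : ℝ))) =
      chartIntegral o (chartAt (EuclideanSpace ℝ (Fin n)) i)
        (funSMul (chartPartition n M i) α) := fun i => by
    rw [chartIntegral]
    simp only [density_funSMul]
    rfl
  simp only [h]
  refine finsum_eq_sum_of_support_subset _ fun i hi => ?_
  by_contra hi'
  refine hi ?_
  change ∫ y in _, density o _ _ y = 0
  simp only [density_funSMul, chartPartition_apply_eq_zero hi', zero_mul]
  simp

theorem integrableOn_density_chartPartition {α : FormField n M n} (hα : α ∈ Form n M n) (i : M) :
    IntegrableOn (density o (chartAt (EuclideanSpace ℝ (Fin n)) i)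
      (funSMul (chartPartition n M i) α)) (chartAt (EuclideanSpace ℝ (Fin n)) i).target :=
  integrableOn_density o (chart_mem_atlas _ i) (funSMul_chartPartition_mem hα i)
    (isCompact_tsupport_chartPartition i) (tsupport_chartPartition_subset i)
    fun _ hx => funSMul_chartPartition_eq_zero α hx

theorem integral_add {α β : FormField n M n} (hα : α ∈ Form n M n) (hβ : β ∈ Form n M n) :
    integral o (α + β) = integral o α + integral o β := by
  rw [integral_eq_sum, integral_eq_sum, integral_eq_sum, ← Finset.sum_add_distrib]
  refine Finset.sum_congr rfl fun i _ => ?_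
  rw [chartIntegral, chartIntegral, chartIntegral, ← MeasureTheory.integral_add
    (integrableOn_density_chartPartition o hα i) (integrableOn_density_chartPartition o hβ i)]
  simp only [density_funSMul, density_add, mul_add]

theorem integral_smul (c : ℝ) (α : FormField n M n) :
    integral o (c • α) = c * integral o α := by
  rw [integral_eq_sum, integral_eq_sum, Finset.mul_sum]
  refine Finset.sum_congr rfl fun i _ => ?_
  rw [chartIntegral, chartIntegral, ← MeasureTheory.integral_const_mul]
  simp only [density_funSMul, density_smul, mul_left_comm]

/-- The integral as a linear functional on smooth top forms. -/
noncomputable def integralLM : Form n M n →ₗ[ℝ] ℝ where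
  toFun α := integral o α.1
  map_add' α β := integral_add o α.2 β.2
  map_smul' c α := integral_smul o c α.1

/-- The integral only depends on the local expressions of the form. -/
theorem integral_congr {α β : FormField n M n}
    (h : ∀ e ∈ atlas (EuclideanSpace ℝ (Fin n)) M, ∀ y ∈ e.target,
      inChart e α y = inChart e β y) : integral o α = integral o β := by
  rw [integral_eq_sum, integral_eq_sum]
  refine Finset.sum_congr rfl fun i _ => ?_
  refine setIntegral_congr_fun
    (chartAt (EuclideanSpace ℝ (Fin n)) i).open_target.measurableSet fun y hy => ?_
  simp only [density_funSMul]
  simp only [density, h _ (chart_mem_atlas _ i) y hy]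

/-- The integral of a form supported in the domain of a single chart is computed in that chart. -/
theorem integral_eq_chartIntegral {e : OpenPartialHomeomorph M (EuclideanSpace ℝ (Fin n))}
    (he : e ∈ atlas (EuclideanSpace ℝ (Fin n)) M) {α : FormField n M n} (hα : α ∈ Form n M n)
    {K : Set M} (hK : IsCompact K) (hKe : K ⊆ e.source) (hαK : ∀ x ∉ K, α x = 0) :
    integral o α = chartIntegral o e α := by
  have hz : ∀ i : M, ∀ x ∉ K, funSMul (chartPartition n M i) α x = 0 := fun i x hx => by
    rw [funSMul, hαK x hx, smul_zero]
  have h1 : ∀ i : M, chartIntegral o (chartAt (EuclideanSpace ℝ (Fin n)) i)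
      (funSMul (chartPartition n M i) α) =
      chartIntegral o e (funSMul (chartPartition n M i) α) := fun i =>
    chartIntegral_eq_of_support o _ (chart_mem_atlas _ i) he
      (fun x hx => funSMul_chartPartition_eq_zero α
        fun h => hx (tsupport_chartPartition_subset i h))
      fun x hx => hz i x fun h => hx (hKe h)
  rw [integral_eq_sum, Finset.sum_congr rfl fun i _ => h1 i]
  simp only [chartIntegral]
  rw [← MeasureTheory.integral_finsetSum _ fun i _ => integrableOn_density o he
    (funSMul_chartPartition_mem hα i) hK hKe (hz i)]
  simp only [density_funSMul, ← Finset.sum_mul, sum_chartPartition, one_mul]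

end Integral

/-! ### Stokes' theorem -/

section Stokes

/-- The integral of a directional derivative of a compactly supported function vanishes. -/
theorem integral_fderiv_apply_eq_zero {V : Type*} [NormedAddCommGroup V] [NormedSpace ℝ V]
    [FiniteDimensional ℝ V] [MeasurableSpace V] [BorelSpace V] (μ : Measure V)
    [μ.IsAddHaarMeasure] {f : V → ℝ} (hf : ContDiff ℝ 1 f) (hc : HasCompactSupport f) (v : V) :
    Integrable (fun y => fderiv ℝ f y v) μ ∧ ∫ y, fderiv ℝ f y v ∂μ = 0 := by
  have h1 : Integrable (fun y => fderiv ℝ f y v) μ := by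
    refine Continuous.integrable_of_hasCompactSupport ?_ (hc.fderiv_apply ℝ v)
    exact (hf.continuous_fderiv (by simp)).clm_apply continuous_const
  have h2 : Integrable f μ := hf.continuous.integrable_of_hasCompactSupport hc
  refine ⟨h1, ?_⟩
  have := integral_mul_fderiv_eq_neg_fderiv_mul_of_integrable (μ := μ) (f := fun _ : V => (1 : ℝ))
    (g := f) (v := v) (by simp) (by simpa using h1) (by simpa using h2)
    (fun _ _ => differentiableAt_const _) (fun _ _ => hf.differentiable (by simp) _)
  simpa using this

variable {m : ℕ} {M : Type*} [TopologicalSpace M]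
  [ChartedSpace (EuclideanSpace ℝ (Fin (m + 1))) M] [IsManifold (𝓡 (m + 1)) ∞ M]
  (o : ManifoldOrientation (m + 1) M)

/-- Stokes' theorem for a form with compact support in the domain of a chart. -/
theorem chartIntegral_extDerivField {e : OpenPartialHomeomorph M (EuclideanSpace ℝ (Fin (m + 1)))}
    (he : e ∈ atlas (EuclideanSpace ℝ (Fin (m + 1))) M) {η : FormField (m + 1) M m}
    (hη : η ∈ Form (m + 1) M m) {K : Set M} (hK : IsCompact K) (hKe : K ⊆ e.source)
    (hηK : ∀ x ∉ K, η x = 0) : chartIntegral o e (extDerivField η) = 0 := by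
  -- in the chart, `d η` is the divergence of the coefficients `f i` of `η`, extended by zero
  let w : Fin (m + 1) → Fin m → EuclideanSpace ℝ (Fin (m + 1)) := fun i =>
    i.removeNth fun j => EuclideanSpace.single j (1 : ℝ)
  let f : Fin (m + 1) → EuclideanSpace ℝ (Fin (m + 1)) → ℝ := fun i =>
    e.target.indicator fun y => chartSign o.at' e y * inChart e η y (w i)
  have hK' : IsCompact (e '' K) := hK.image_of_continuousOn (e.continuousOn.mono hKe)
  have hf0 : ∀ i, ∀ y ∉ e '' K, f i y = 0 := fun i y hy => by
    by_cases hye : y ∈ e.target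
    · refine (Set.indicator_of_mem hye _).trans ?_
      rw [inChart_eq_zero e (hηK _ fun h => hy ⟨_, h, e.right_inv hye⟩)]
      exact mul_zero _
    · exact Set.indicator_of_notMem hye _
  have hev : ∀ i, ∀ y ∈ e.target, f i =ᶠ[nhds y] fun z =>
      chartSign o.at' e y * inChart e η z (w i) := fun i y hy => by
    filter_upwards [o.locally_constant e he y hy, e.open_target.mem_nhds hy] with z hz hz'
    rw [← hz]
    exact Set.indicator_of_mem hz' _
  have happ : ∀ i, ∀ y ∈ e.target, HasFDerivAt (fun z => inChart e η z (w i))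
      ((ContinuousAlternatingMap.apply ℝ (EuclideanSpace ℝ (Fin (m + 1))) ℝ (w i)).comp
        (fderiv ℝ (inChart e η) y)) y := fun i y hy =>
    (ContinuousAlternatingMap.apply ℝ (EuclideanSpace ℝ (Fin (m + 1))) ℝ
      (w i)).hasFDerivAt.comp y (inChart_differentiableAt hη he hy).hasFDerivAt
  have hsm : ∀ i, ContDiff ℝ 1 (f i) := fun i => by
    rw [contDiff_iff_contDiffAt]
    intro y
    by_cases hye : y ∈ e.target
    · refine ContDiffAt.congr_of_eventuallyEq ?_ (hev i y hye)
      refine contDiffAt_const.mul ?_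
      exact (ContinuousAlternatingMap.apply ℝ (EuclideanSpace ℝ (Fin (m + 1))) ℝ
        (w i)).contDiff.contDiffAt.comp y (((mem_Form.1 hη e he).contDiffAt
          (e.open_target.mem_nhds hye)).of_le (by simp))
    · have hy : y ∉ e '' K := by
        rintro ⟨x, hx, rfl⟩
        exact hye (e.map_source (hKe hx))
      refine (contDiffAt_const (c := (0 : ℝ))).congr_of_eventuallyEq ?_
      filter_upwards [hK'.isClosed.isOpen_compl.mem_nhds hy] with z hz
      exact hf0 i z hz
  have hcs : ∀ i, HasCompactSupport (f i) := fun i => HasCompactSupport.intro hK' (hf0 i)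
  have hint := fun i => integral_fderiv_apply_eq_zero volume (hsm i) (hcs i)
    (EuclideanSpace.single i (1 : ℝ))
  have hdens : ∀ y ∈ e.target, density o e (extDerivField η) y =
      ∑ i : Fin (m + 1), (-1 : ℝ) ^ (i : ℕ) *
        fderiv ℝ (f i) y (EuclideanSpace.single i (1 : ℝ)) := fun y hy => by
    rw [density, inChart_extDerivField hη he hy, extDeriv,
      ContinuousAlternatingMap.alternatizeUncurryFin_apply, Finset.mul_sum]
    refine Finset.sum_congr rfl fun i _ => ?_
    rw [(hev i y hy).fderiv_eq, ((happ i y hy).const_mul _).fderiv, zsmul_eq_mul]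
    push_cast
    exact mul_left_comm _ _ _
  have hoff : ∀ y ∉ e.target, ∑ i : Fin (m + 1), (-1 : ℝ) ^ (i : ℕ) *
        fderiv ℝ (f i) y (EuclideanSpace.single i (1 : ℝ)) = 0 := fun y hy => by
    refine Finset.sum_eq_zero fun i _ => ?_
    have hyK : y ∉ tsupport (f i) := fun h => by
      obtain ⟨x, hx, rfl⟩ := closure_minimal (fun z hz => by
        by_contra h'
        exact hz (hf0 i z h')) hK'.isClosed h
      exact hy (e.map_source (hKe hx))
    rw [image_eq_zero_of_notMem_tsupport fun h => hyK (tsupport_fderiv_subset ℝ h)]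
    simp
  rw [chartIntegral, setIntegral_congr_fun e.open_target.measurableSet hdens,
    setIntegral_eq_integral_of_forall_compl_eq_zero hoff,
    MeasureTheory.integral_finsetSum _ fun i _ => (hint i).1.const_mul _]
  refine Finset.sum_eq_zero fun i _ => ?_
  rw [MeasureTheory.integral_const_mul, (hint i).2, mul_zero]

/-- The exterior derivative does not enlarge the (closed) support. -/
theorem extDerivField_eq_zero {n k : ℕ} {M : Type*} [TopologicalSpace M]
    [ChartedSpace (EuclideanSpace ℝ (Fin n)) M] {η : FormField n M k} {K : Set M}
    (hK : IsClosed K) (hηK : ∀ x ∉ K, η x = 0) {x : M} (hx : x ∉ K) :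
    extDerivField η x = 0 := by
  have hev : inChart (chartAt (EuclideanSpace ℝ (Fin n)) x) η =ᶠ[nhds
      (chartAt (EuclideanSpace ℝ (Fin n)) x x)] fun _ => 0 := by
    have hc := (chartAt (EuclideanSpace ℝ (Fin n)) x).continuousAt_symm
      (mem_chart_target (EuclideanSpace ℝ (Fin n)) x)
    have : Kᶜ ∈ nhds ((chartAt (EuclideanSpace ℝ (Fin n)) x).symm
        (chartAt (EuclideanSpace ℝ (Fin n)) x x)) := by
      rw [(chartAt (EuclideanSpace ℝ (Fin n)) x).left_inv (mem_chart_source _ x)]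
      exact hK.isOpen_compl.mem_nhds hx
    filter_upwards [hc.preimage_mem_nhds this] with z hz
    exact inChart_eq_zero _ (hηK _ hz)
  have h0 : extDeriv (inChart (chartAt (EuclideanSpace ℝ (Fin n)) x) η)
      (chartAt (EuclideanSpace ℝ (Fin n)) x x) = 0 := by
    rw [hev.extDeriv_eq, extDeriv, fderiv_const_apply]
    exact (ContinuousAlternatingMap.alternatizeUncurryFinCLM ℝ _ ℝ).map_zero
  rw [extDerivField, h0]
  rfl

/-- Stokes' theorem on a compact manifold without boundary. -/
theorem integral_extDerivField [T2Space M] [CompactSpace M] {η : FormField (m + 1) M m}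
    (hη : η ∈ Form (m + 1) M m) : integral o (extDerivField η) = 0 := by
  let ηi : M → Form (m + 1) M m := fun i =>
    ⟨funSMul (chartPartition (m + 1) M i) η, funSMul_chartPartition_mem hη i⟩
  have hsum : ∑ i ∈ partitionIndices (m + 1) M, ηi i = ⟨η, hη⟩ := by
    ext1
    rw [Submodule.coe_sum]
    exact sum_funSMul_chartPartition η
  have h1 : integral o (extDerivField η) = integralLM o (d (m + 1) M m ⟨η, hη⟩) := rfl
  rw [h1, ← hsum, map_sum, map_sum]
  refine Finset.sum_eq_zero fun i _ => ?_
  have h0 : ∀ x ∉ tsupport (chartPartition (m + 1) M i), (ηi i).1 x = 0 :=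
    fun x hx => funSMul_chartPartition_eq_zero η hx
  change integral o (extDerivField (ηi i).1) = 0
  rw [integral_eq_chartIntegral o (chart_mem_atlas _ i) (extDerivField_mem (ηi i).2)
    (isCompact_tsupport_chartPartition i) (tsupport_chartPartition_subset i)
    fun x hx => extDerivField_eq_zero (isClosed_tsupport _) h0 hx]
  exact chartIntegral_extDerivField o (chart_mem_atlas _ i) (ηi i).2
    (isCompact_tsupport_chartPartition i) (tsupport_chartPartition_subset i) h0

end Stokes

/-! ### The intersection form -/

section Intersection

variable {n : ℕ} {M : Type*} [TopologicalSpace M] [ChartedSpace (EuclideanSpace ℝ (Fin n)) M]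
  [IsManifold (𝓡 n) ∞ M] [T2Space M] [CompactSpace M]

/-- A closed form and an exact form in the middle degree pair to zero: the wedge product of the
two is exact, and Stokes' theorem applies. -/
theorem integral_wedgeField_exact_left {p : ℕ} (h : p + p = n) (o : ManifoldOrientation n M)
    {α β : Form n M p} (hα : α ∈ Exact n M p) (hβ : β ∈ Closed n M p) :
    integral o (wedgeField h α.1 β.1) = 0 := by
  rcases p with _ | k
  · have h0 : α.1 = (0 : ℝ) • α.1 := by
      rw [zero_smul, (Submodule.mem_bot ℝ).1 hα]
      rfl
    rw [h0, wedgeField_smul_left, integral_smul, zero_mul]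
  · obtain ⟨m, rfl⟩ : ∃ m, n = m + 1 := ⟨k + 1 + k, by omega⟩
    obtain ⟨η, rfl⟩ := hα
    have hkm : k + (k + 1) = m := by omega
    have hβ0 : extDerivField β.1 = 0 := congrArg Subtype.val (LinearMap.mem_ker.1 hβ)
    rw [← integral_extDerivField o (wedgeField_mem hkm η.2 β.2)]
    refine integral_congr o fun e he y hy => ?_
    exact (inChart_extDerivField_wedgeField hkm h η.2 β.2 hβ0 he hy).symm

/-- The pairing of closed forms in the middle degree. -/
noncomputable def closedPairing {p : ℕ} (h : p + p = n) (o : ManifoldOrientation n M) :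
    LinearMap.BilinForm ℝ (Closed n M p) :=
  have hr : ∀ α β β' : FormField n M p, wedgeField h α (β + β') =
      wedgeField h α β + wedgeField h α β' := fun α β β' => by
    rw [wedgeField_comm h h, wedgeField_add_left, smul_add, ← wedgeField_comm,
      ← wedgeField_comm]
  have hs : ∀ (c : ℝ) (α β : FormField n M p), wedgeField h α (c • β) =
      c • wedgeField h α β := fun c α β => by
    rw [wedgeField_comm h h, wedgeField_smul_left, smul_comm, ← wedgeField_comm]
  LinearMap.mk₂ ℝ (fun α β => integral o (wedgeField h α.1.1 β.1.1))
    (fun α α' β => (congrArg (integral o) (wedgeField_add_left h α.1.1 α'.1.1 β.1.1)).trans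
      (integral_add o (wedgeField_mem h α.1.2 β.1.2) (wedgeField_mem h α'.1.2 β.1.2)))
    (fun c α β => (congrArg (integral o) (wedgeField_smul_left h c α.1.1 β.1.1)).trans
      (integral_smul o c _))
    (fun α β β' => (congrArg (integral o) (hr α.1.1 β.1.1 β'.1.1)).trans
      (integral_add o (wedgeField_mem h α.1.2 β.1.2) (wedgeField_mem h α.1.2 β'.1.2)))
    (fun c α β => (congrArg (integral o) (hs c α.1.1 β.1.1)).trans (integral_smul o c _))

theorem closedPairing_apply {p : ℕ} (h : p + p = n) (o : ManifoldOrientation n M)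
    (α β : Closed n M p) : closedPairing h o α β = integral o (wedgeField h α.1.1 β.1.1) := rfl

theorem closedPairing_swap {p : ℕ} (h : p + p = n) (o : ManifoldOrientation n M)
    (α β : Closed n M p) : closedPairing h o β α = (-1) ^ p * closedPairing h o α β := by
  have hp : (-1 : ℝ) ^ (p * p) = (-1) ^ p := by
    rcases Nat.even_or_odd p with hp | hp
    · rw [hp.neg_one_pow, (hp.mul_right p).neg_one_pow]
    · rw [hp.neg_one_pow, (hp.mul hp).neg_one_pow]
  rw [closedPairing_apply, wedgeField_comm h h, integral_smul, hp]
  rfl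

theorem closedPairing_exact_left {p : ℕ} (h : p + p = n) (o : ManifoldOrientation n M)
    {α : Closed n M p} (hα : α ∈ (Exact n M p).submoduleOf (Closed n M p)) (β : Closed n M p) :
    closedPairing h o α β = 0 :=
  integral_wedgeField_exact_left h o hα β.2

theorem closedPairing_exact_right {p : ℕ} (h : p + p = n) (o : ManifoldOrientation n M)
    (α : Closed n M p) {β : Closed n M p}
    (hβ : β ∈ (Exact n M p).submoduleOf (Closed n M p)) : closedPairing h o α β = 0 := by
  rw [closedPairing_swap, closedPairing_exact_left h o hβ, mul_zero]

theorem existsUnique_isSignatureForm {p : ℕ} (h : p + p = n) (o : ManifoldOrientation n M) :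
    ∃! Q : LinearMap.BilinForm ℝ (Cohomology n M p), IsSignatureForm h o Q := by
  let N := (Exact n M p).submoduleOf (Closed n M p)
  let B : Closed n M p →ₗ[ℝ] Cohomology n M p →ₗ[ℝ] ℝ :=
    { toFun := fun α => N.liftQ (closedPairing h o α)
        fun β hβ => closedPairing_exact_right h o α hβ
      map_add' := fun α α' => by
        ext β
        exact DFunLike.congr_fun (map_add (closedPairing h o) α α') β
      map_smul' := fun c α => by
        ext β
        exact DFunLike.congr_fun (map_smul (closedPairing h o) c α) β }
  refine ⟨N.liftQ B fun α hα => ?_, fun α β => rfl, fun Q hQ => ?_⟩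
  · refine LinearMap.mem_ker.2 (LinearMap.ext fun b => ?_)
    induction b using Submodule.Quotient.induction_on with
    | H β => exact closedPairing_exact_left h o hα β
  · refine LinearMap.ext fun a => LinearMap.ext fun b => ?_
    induction a using Submodule.Quotient.induction_on with
    | H α =>
      induction b using Submodule.Quotient.induction_on with
      | H β => exact hQ α β

theorem IsSignatureForm.swap {p : ℕ} {h : p + p = n} {o : ManifoldOrientation n M}
    {Q : LinearMap.BilinForm ℝ (Cohomology n M p)} (hQ : IsSignatureForm h o Q)
    (a b : Cohomology n M p) : Q b a = (-1) ^ p * Q a b := by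
  induction a using Submodule.Quotient.induction_on with
  | H α =>
    induction b using Submodule.Quotient.induction_on with
    | H β =>
      have := closedPairing_swap h o α β
      rwa [closedPairing_apply, closedPairing_apply, ← hQ, ← hQ] at this

theorem even_iff_exists_eq_four_mul {p : ℕ} (h : p + p = n) : Even p ↔ ∃ k, n = 4 * k :=
  ⟨fun ⟨k, hk⟩ => ⟨k, by omega⟩, fun ⟨k, hk⟩ => ⟨k, by omega⟩⟩

theorem IsSignatureForm.isSymm_iff {p : ℕ} {h : p + p = n} {o : ManifoldOrientation n M}
    {Q : LinearMap.BilinForm ℝ (Cohomology n M p)} (hQ : IsSignatureForm h o Q) :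
    Q.IsSymm ↔ (∃ k : ℕ, n = 4 * k) ∨ Q = 0 := by
  rw [← even_iff_exists_eq_four_mul h]
  constructor
  · intro hs
    rcases Nat.even_or_odd p with hp | hp
    · exact Or.inl hp
    · refine Or.inr (LinearMap.ext fun a => LinearMap.ext fun b => ?_)
      have h1 := hQ.swap a b
      have h2 : Q a b = Q b a := hs.eq a b
      rw [hp.neg_one_pow] at h1
      change Q a b = 0
      linarith
  · rintro (hp | rfl)
    · refine ⟨fun a b => ?_⟩
      have h1 := hQ.swap a b
      rw [hp.neg_one_pow, one_mul] at h1
      exact h1.symm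
    · exact ⟨fun a b => rfl⟩

end Intersection

/-! ### The torus -/

section Torus

/-- The `n`-dimensional torus `(ℝ / ℤ)ⁿ`. -/
def Torus (n : ℕ) : Type := Fin n → AddCircle (1 : ℝ)

variable {n : ℕ}

instance : TopologicalSpace (Torus n) :=
  inferInstanceAs (TopologicalSpace (Fin n → AddCircle (1 : ℝ)))

instance : CompactSpace (Torus n) :=
  inferInstanceAs (CompactSpace (Fin n → AddCircle (1 : ℝ)))

instance : T2Space (Torus n) :=
  inferInstanceAs (T2Space (Fin n → AddCircle (1 : ℝ)))

/-- The covering map from Euclidean space to the torus. -/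
noncomputable def torusProj (n : ℕ) (y : EuclideanSpace ℝ (Fin n)) : Torus n :=
  fun i => (y i : AddCircle (1 : ℝ))

/-- Translation by the difference of two points in the same fibre commutes with the covering. -/
theorem torusProj_add_sub {z w : EuclideanSpace ℝ (Fin n)} (h : torusProj n z = torusProj n w)
    (y : EuclideanSpace ℝ (Fin n)) : torusProj n (y + (z - w)) = torusProj n y := by
  funext i
  have hi : ((z i : ℝ) : AddCircle (1 : ℝ)) = (w i : ℝ) := congrFun h i
  simp only [torusProj, PiLp.add_apply, PiLp.sub_apply, AddCircle.coe_add, AddCircle.coe_sub, hi,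
    sub_self, add_zero]

/-- The local inverse of `torusProj` with values in the open unit cube with lowest corner `v`. -/
noncomputable def torusChart (v : EuclideanSpace ℝ (Fin n)) :
    OpenPartialHomeomorph (Torus n) (EuclideanSpace ℝ (Fin n)) :=
  ((EuclideanSpace.equiv (Fin n) ℝ).toHomeomorph.toOpenPartialHomeomorph.trans
    (OpenPartialHomeomorph.pi fun i => AddCircle.openPartialHomeomorphCoe (1 : ℝ) (v i))).symm

theorem torusChart_symm_apply (v y : EuclideanSpace ℝ (Fin n)) :
    (torusChart v).symm y = torusProj n y := rfl

theorem exists_mem_torusChart_source (x : Torus n) :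
    ∃ v : EuclideanSpace ℝ (Fin n), x ∈ (torusChart v).source := by
  choose r hr using fun i => QuotientAddGroup.mk_surjective (x i)
  let y : EuclideanSpace ℝ (Fin n) := WithLp.toLp 2 r
  let v : EuclideanSpace ℝ (Fin n) := WithLp.toLp 2 fun i => r i - 1 / 2
  have hy : y ∈ (torusChart v).target := by
    refine ⟨trivial, fun i _ => ?_⟩
    change r i - 1 / 2 < r i ∧ r i < r i - 1 / 2 + 1
    constructor <;> linarith
  have hx : (torusChart v).symm y = x := funext hr
  exact ⟨v, hx ▸ (torusChart v).map_target hy⟩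

/-- The charts of the torus are all the local inverses of the covering map. -/
noncomputable instance : ChartedSpace (EuclideanSpace ℝ (Fin n)) (Torus n) where
  atlas := {e | ∀ y, e.symm y = torusProj n y}
  chartAt x := torusChart (exists_mem_torusChart_source x).choose
  mem_chart_source x := (exists_mem_torusChart_source x).choose_spec
  chart_mem_atlas _ := torusChart_symm_apply _

/-- The transition maps between charts of the torus are locally translations. -/
theorem torus_transition_eventuallyEq
    {e c : OpenPartialHomeomorph (Torus n) (EuclideanSpace ℝ (Fin n))}
    (he : e ∈ atlas (EuclideanSpace ℝ (Fin n)) (Torus n))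
    (hc : c ∈ atlas (EuclideanSpace ℝ (Fin n)) (Torus n))
    {y : EuclideanSpace ℝ (Fin n)} (hyc : e.symm y ∈ c.source) :
    c ∘ e.symm =ᶠ[nhds y] fun z => z + (c (e.symm y) - y) := by
  have h1 : torusProj n (c (e.symm y)) = torusProj n y := by
    rw [← hc, c.left_inv hyc, he]
  have hcont : ContinuousAt (fun z : EuclideanSpace ℝ (Fin n) => z + (c (e.symm y) - y)) y := by
    fun_prop
  have hmem : c.target ∈ nhds (y + (c (e.symm y) - y)) := by
    rw [add_sub_cancel]
    exact c.open_target.mem_nhds (c.map_source hyc)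
  filter_upwards [hcont.preimage_mem_nhds hmem] with z hz
  rw [Function.comp_apply, he, ← torusProj_add_sub h1 z, ← hc, c.right_inv hz]

instance : IsManifold (𝓡 n) ∞ (Torus n) := by
  refine isManifold_of_contDiffOn _ _ _ fun e c he hc => ?_
  intro y hy
  have hyc : e.symm y ∈ c.source := by
    have := hy.1
    simp only [modelWithCornersSelf_coe_symm, Set.preimage_id] at this
    rw [OpenPartialHomeomorph.trans_source] at this
    exact this.2
  have := (contDiffAt_id.add contDiffAt_const : ContDiffAt ℝ ∞
    (fun z => z + (c (e.symm y) - y)) y).congr_of_eventuallyEq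
      (torus_transition_eventuallyEq he hc hyc)
  exact this.contDiffWithinAt

/-- The tangent spaces of the torus are identified with the model space in such a way that the
covering map has the identity as derivative. -/
theorem mfderiv_torus_symm {e : OpenPartialHomeomorph (Torus n) (EuclideanSpace ℝ (Fin n))}
    (he : e ∈ atlas (EuclideanSpace ℝ (Fin n)) (Torus n))
    {y : EuclideanSpace ℝ (Fin n)} (hy : y ∈ e.target) :
    (mfderiv (𝓡 n) (𝓡 n) e.symm y :
      EuclideanSpace ℝ (Fin n) →L[ℝ] EuclideanSpace ℝ (Fin n)) =
      ContinuousLinearMap.id ℝ (EuclideanSpace ℝ (Fin n)) := by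
  have h : HasMFDerivAt (𝓡 n) (𝓡 n) e.symm y
      (ContinuousLinearMap.id ℝ (EuclideanSpace ℝ (Fin n))) := by
    refine ⟨e.continuousAt_symm hy, ?_⟩
    have h1 := torus_transition_eventuallyEq he
      (chart_mem_atlas (EuclideanSpace ℝ (Fin n)) (e.symm y)) (mem_chart_source _ (e.symm y))
    have h2 := (((hasFDerivAt_id (𝕜 := ℝ) y).add_const _).congr_of_eventuallyEq h1).hasFDerivWithinAt
      (s := Set.univ)
    simp only [writtenInExtChartAt, extChartAt, mfld_simps]
    exact h2
  exact h.mfderiv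

/-- The translation-invariant form on the torus with given value. -/
def constField {k : ℕ} (A : EuclideanSpace ℝ (Fin n) [⋀^Fin k]→L[ℝ] ℝ) :
    FormField n (Torus n) k := fun _ => A

theorem inChart_constField {k : ℕ} (A : EuclideanSpace ℝ (Fin n) [⋀^Fin k]→L[ℝ] ℝ)
    {e : OpenPartialHomeomorph (Torus n) (EuclideanSpace ℝ (Fin n))}
    (he : e ∈ atlas (EuclideanSpace ℝ (Fin n)) (Torus n))
    {y : EuclideanSpace ℝ (Fin n)} (hy : y ∈ e.target) : inChart e (constField A) y = A :=
  (congrArg A.compContinuousLinearMap (mfderiv_torus_symm he hy)).trans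
    (ContinuousAlternatingMap.ext fun _ => rfl)

theorem constField_mem {k : ℕ} (A : EuclideanSpace ℝ (Fin n) [⋀^Fin k]→L[ℝ] ℝ) :
    constField A ∈ Form n (Torus n) k :=
  mem_Form.2 fun _ he => contDiffOn_const.congr fun _ hy => inChart_constField A he hy

theorem constField_mem_Closed {k : ℕ} (A : EuclideanSpace ℝ (Fin n) [⋀^Fin k]→L[ℝ] ℝ) :
    (⟨constField A, constField_mem A⟩ : Form n (Torus n) k) ∈ Closed n (Torus n) k := by
  refine LinearMap.mem_ker.2 (Subtype.ext (funext fun x => ?_))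
  have hev : inChart (chartAt (EuclideanSpace ℝ (Fin n)) x) (constField A) =ᶠ[nhds
      (chartAt (EuclideanSpace ℝ (Fin n)) x x)] fun _ => A := by
    filter_upwards [(chartAt (EuclideanSpace ℝ (Fin n)) x).open_target.mem_nhds
      (mem_chart_target _ x)] with y hy
    exact inChart_constField A (chart_mem_atlas _ x) hy
  have h0 : extDeriv (inChart (chartAt (EuclideanSpace ℝ (Fin n)) x) (constField A))
      (chartAt (EuclideanSpace ℝ (Fin n)) x x) = 0 := by
    rw [hev.extDeriv_eq, extDeriv, fderiv_const_apply]
    exact (ContinuousAlternatingMap.alternatizeUncurryFinCLM ℝ _ ℝ).map_zero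
  change extDerivField (constField A) x = 0
  rw [extDerivField, h0]
  rfl

/-- The orientation of the Euclidean space `ℝⁿ` by its standard basis. -/
noncomputable def standardOrientation (n : ℕ) :
    Orientation ℝ (EuclideanSpace ℝ (Fin n)) (Fin n) :=
  (EuclideanSpace.basisFun (Fin n) ℝ).toBasis.orientation

/-- The sign of the standard basis with respect to the chosen representative of the standard
orientation. -/
noncomputable def standardSign (n : ℕ) : ℝ :=
  ((SignType.sign ((standardOrientation n).someVector
    (fun i => EuclideanSpace.single i (1 : ℝ))) : SignType) : ℝ)

theorem standardSign_ne_zero : standardSign n ≠ 0 := by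
  have h : (standardOrientation n).someVector (fun i => EuclideanSpace.single i (1 : ℝ)) ≠ 0 := by
    intro h0
    refine (standardOrientation n).someVector_ne_zero ?_
    rw [AlternatingMap.eq_smul_basis_det (EuclideanSpace.basisFun (Fin n) ℝ).toBasis
      ((standardOrientation n).someVector)]
    have hb : ((EuclideanSpace.basisFun (Fin n) ℝ).toBasis : Fin n → EuclideanSpace ℝ (Fin n)) =
        fun i => EuclideanSpace.single i (1 : ℝ) := by
      funext i
      simp
    rw [hb, h0, zero_smul]
  rcases h.lt_or_gt with h | h
  · simp [standardSign, sign_neg h]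
  · simp [standardSign, sign_pos h]

theorem chartSign_torus {e : OpenPartialHomeomorph (Torus n) (EuclideanSpace ℝ (Fin n))}
    (he : e ∈ atlas (EuclideanSpace ℝ (Fin n)) (Torus n))
    {y : EuclideanSpace ℝ (Fin n)} (hy : y ∈ e.target) :
    chartSign (fun _ : Torus n => standardOrientation n) e y = standardSign n := by
  have hf : (frame e y : Fin n → EuclideanSpace ℝ (Fin n)) =
      fun i => EuclideanSpace.single i (1 : ℝ) := funext fun i =>
    congrArg (fun L : EuclideanSpace ℝ (Fin n) →L[ℝ] EuclideanSpace ℝ (Fin n) =>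
      L (EuclideanSpace.single i (1 : ℝ))) (mfderiv_torus_symm he hy)
  exact congrArg (fun v : Fin n → EuclideanSpace ℝ (Fin n) =>
    ((SignType.sign ((standardOrientation n).someVector v) : SignType) : ℝ)) hf

/-- The translation-invariant orientation of the torus. -/
noncomputable def torusOrientation (n : ℕ) : ManifoldOrientation n (Torus n) where
  at' _ := standardOrientation n
  locally_constant e he y hy := by
    filter_upwards [e.open_target.mem_nhds hy] with z hz
    rw [chartSign_torus he hz, chartSign_torus he hy]

/-- A top form whose density is the same nonzero constant in all charts has nonzero integral. -/
theorem integral_ne_zero_of_density_eq {M : Type*} [TopologicalSpace M]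
    [ChartedSpace (EuclideanSpace ℝ (Fin n)) M] [IsManifold (𝓡 n) ∞ M] [T2Space M]
    [CompactSpace M] [Nonempty M] (o : ManifoldOrientation n M) {α : FormField n M n}
    (hα : α ∈ Form n M n) {c : ℝ} (hc : c ≠ 0)
    (h : ∀ e ∈ atlas (EuclideanSpace ℝ (Fin n)) M, ∀ y ∈ e.target, density o e α y = c) :
    integral o α ≠ 0 := by
  let f : M → EuclideanSpace ℝ (Fin n) → ℝ := fun i y =>
    chartPartition n M i ((chartAt (EuclideanSpace ℝ (Fin n)) i).symm y)
  let t : M → Set (EuclideanSpace ℝ (Fin n)) := fun i =>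
    (chartAt (EuclideanSpace ℝ (Fin n)) i).target
  have ht : ∀ i, MeasurableSet (t i) := fun i =>
    (chartAt (EuclideanSpace ℝ (Fin n)) i).open_target.measurableSet
  have hd : ∀ i, ∀ y ∈ t i, density o (chartAt (EuclideanSpace ℝ (Fin n)) i)
      (funSMul (chartPartition n M i) α) y = f i y * c := fun i y hy => by
    rw [density_funSMul, h _ (chart_mem_atlas _ i) y hy]
  have hint : ∀ i, IntegrableOn (f i) (t i) := fun i => by
    have h1 := ((integrableOn_congr_fun (hd i) (ht i)).1
      (integrableOn_density_chartPartition o hα i)).mul_const c⁻¹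
    have h2 : (fun y => f i y * c * c⁻¹) = f i := funext fun y => mul_inv_cancel_right₀ hc _
    rwa [h2] at h1
  have h0 : ∀ i, 0 ≤ᵐ[volume.restrict (t i)] f i := fun i =>
    Filter.Eventually.of_forall fun y => (chartPartition n M).nonneg i _
  have hsum : integral o α = (∑ i ∈ partitionIndices n M, ∫ y in t i, f i y) * c := by
    rw [integral_eq_sum, Finset.sum_mul]
    refine Finset.sum_congr rfl fun i _ => ?_
    rw [chartIntegral, setIntegral_congr_fun (ht i) (hd i), MeasureTheory.integral_mul_const]
  rw [hsum]
  refine mul_ne_zero (ne_of_gt ?_) hc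
  obtain ⟨x⟩ := ‹Nonempty M›
  obtain ⟨i, hi⟩ := (chartPartition n M).exists_pos_of_mem (Set.mem_univ x)
  have hiJ : i ∈ partitionIndices n M := by
    by_contra h'
    exact hi.ne' (chartPartition_apply_eq_zero h' x)
  refine Finset.sum_pos' (fun j _ => integral_nonneg_of_ae (h0 j)) ⟨i, hiJ, ?_⟩
  rw [setIntegral_pos_iff_support_of_nonneg_ae (h0 i) (hint i)]
  -- the support is open and contains the image of the point `x` in the chart
  have hopen : IsOpen (Function.support (f i) ∩ t i) := by
    have := (chartAt (EuclideanSpace ℝ (Fin n)) i).symm.isOpen_inter_preimage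
      ((chartPartition n M i).contMDiff.continuous.isOpen_support)
    rw [Set.inter_comm]
    exact this
  refine hopen.measure_pos volume ⟨chartAt (EuclideanSpace ℝ (Fin n)) i x, ?_, ?_⟩
  · have hx : x ∈ (chartAt (EuclideanSpace ℝ (Fin n)) i).source :=
      tsupport_chartPartition_subset i (subset_tsupport _ hi.ne')
    change chartPartition n M i _ ≠ 0
    rw [(chartAt (EuclideanSpace ℝ (Fin n)) i).left_inv hx]
    exact hi.ne'
  · exact (chartAt (EuclideanSpace ℝ (Fin n)) i).map_source
      (tsupport_chartPartition_subset i (subset_tsupport _ hi.ne'))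

/-- The form `dx_{l 0} ∧ ... ∧ dx_{l (k - 1)}`. -/
noncomputable def coordForm {k : ℕ} (l : Fin k → Fin n) :
    EuclideanSpace ℝ (Fin n) [⋀^Fin k]→L[ℝ] ℝ :=
  ContinuousMultilinearMap.alternatization
    ((ContinuousMultilinearMap.mkPiAlgebra ℝ (Fin k) ℝ).compContinuousLinearMap
      fun j => EuclideanSpace.proj (l j))

/-- The wedge product of the first `p` and the last `q` coordinate differentials is the volume
form. -/
theorem wedge_coordForm_apply {p q : ℕ} (h : p + q = n) :
    wedge h (coordForm fun i => Fin.cast h (Fin.castAdd q i))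
      (coordForm fun j => Fin.cast h (Fin.natAdd p j))
      (fun j => EuclideanSpace.single j (1 : ℝ)) = 1 := by
  subst h
  set a : MultilinearMap ℝ (fun _ : Fin p => EuclideanSpace ℝ (Fin (p + q))) ℝ :=
    ((ContinuousMultilinearMap.mkPiAlgebra ℝ (Fin p) ℝ).compContinuousLinearMap
      fun j => EuclideanSpace.proj (Fin.castAdd q j)).toMultilinearMap with ha
  set b : MultilinearMap ℝ (fun _ : Fin q => EuclideanSpace ℝ (Fin (p + q))) ℝ :=
    ((ContinuousMultilinearMap.mkPiAlgebra ℝ (Fin q) ℝ).compContinuousLinearMap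
      fun j => EuclideanSpace.proj (Fin.natAdd p j)).toMultilinearMap with hb
  have key := congrArg (LinearMap.mul' ℝ ℝ) (DFunLike.congr_fun
    (MultilinearMap.domCoprod_alternization a b)
      ((fun j => EuclideanSpace.single j (1 : ℝ)) ∘ finSumFinEquiv))
  have hA : (coordForm (fun i : Fin p => Fin.castAdd q i)).toAlternatingMap =
      MultilinearMap.alternatization a :=
    ContinuousMultilinearMap.alternatization_apply_toAlternatingMap _
  have hB : (coordForm (fun i : Fin q => Fin.natAdd p i)).toAlternatingMap =
      MultilinearMap.alternatization b :=
    ContinuousMultilinearMap.alternatization_apply_toAlternatingMap _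
  rw [← hA, ← hB] at key
  refine Eq.trans key.symm ?_
  rw [MultilinearMap.alternatization_apply, map_sum, Finset.sum_eq_single 1]
  · simp [a, b]
  · intro σ _ hσ
    rw [Units.smul_def, map_zsmul]
    refine (congrArg _ ?_).trans (smul_zero _)
    obtain ⟨x, hx⟩ : ∃ x, σ x ≠ x := by
      by_contra! h'
      exact hσ (Equiv.ext h')
    have hx' : finSumFinEquiv x ≠ finSumFinEquiv (σ x) := fun h' =>
      hx (finSumFinEquiv.injective h').symm
    -- one of the two factors contains the vanishing coefficient at `x`
    refine (LinearMap.mul'_apply ..).trans ?_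
    rcases x with i | j
    · refine mul_eq_zero_of_left ?_ _
      refine Finset.prod_eq_zero (Finset.mem_univ i) ?_
      simpa using hx'
    · refine mul_eq_zero_of_right _ ?_
      refine Finset.prod_eq_zero (Finset.mem_univ j) ?_
      simpa using hx'
  · simp

/-- On the torus of dimension `2 p` the intersection form does not vanish. -/
theorem IsSignatureForm.torus_ne_zero {p : ℕ} {h : p + p = n}
    {Q : LinearMap.BilinForm ℝ (Cohomology n (Torus n) p)}
    (hQ : IsSignatureForm h (torusOrientation n) Q) : Q ≠ 0 := by
  let A : EuclideanSpace ℝ (Fin n) [⋀^Fin p]→L[ℝ] ℝ :=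
    coordForm fun i => Fin.cast h (Fin.castAdd p i)
  let B : EuclideanSpace ℝ (Fin n) [⋀^Fin p]→L[ℝ] ℝ :=
    coordForm fun i => Fin.cast h (Fin.natAdd p i)
  intro h0
  have h1 := hQ ⟨_, constField_mem_Closed A⟩ ⟨_, constField_mem_Closed B⟩
  rw [h0] at h1
  have : Nonempty (Torus n) := ⟨torusProj n 0⟩
  refine integral_ne_zero_of_density_eq (torusOrientation n)
    (wedgeField_mem h (constField_mem A) (constField_mem B)) (standardSign_ne_zero (n := n))
    (fun e he y hy => ?_) h1.symm
  have hs : chartSign (torusOrientation n).at' e y = standardSign n := chartSign_torus he hy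
  rw [density, hs, inChart_wedgeField, inChart_constField A he hy, inChart_constField B he hy,
    wedge_coordForm_apply h, mul_one]

end Torus

end DeRham

/-! ### Symmetry of the intersection form -/

theorem mainTheorem8 (p n : ℕ) (hn : p + p = n) :
    (∀ (M : Type*) [TopologicalSpace M] [ChartedSpace (EuclideanSpace ℝ (Fin n)) M]
        [IsManifold (𝓡 n) ∞ M] [T2Space M] [CompactSpace M] (o : DeRham.ManifoldOrientation n M),
      (∃! Q : LinearMap.BilinForm ℝ (DeRham.Cohomology n M p), DeRham.IsSignatureForm hn o Q) ∧
      ∀ Q : LinearMap.BilinForm ℝ (DeRham.Cohomology n M p), DeRham.IsSignatureForm hn o Q →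
        (∀ a b, Q b a = (-1) ^ p * Q a b) ∧
        (Q.IsSymm ↔ (∃ k : ℕ, n = 4 * k) ∨ Q = 0)) ∧
    ((∀ (M : Type) [TopologicalSpace M] [ChartedSpace (EuclideanSpace ℝ (Fin n)) M]
        [IsManifold (𝓡 n) ∞ M] [T2Space M] [CompactSpace M] (o : DeRham.ManifoldOrientation n M)
        (Q : LinearMap.BilinForm ℝ (DeRham.Cohomology n M p)),
        DeRham.IsSignatureForm hn o Q → Q.IsSymm) ↔
      ∃ k : ℕ, n = 4 * k) := by
  refine ⟨fun M _ _ _ _ _ o => ⟨DeRham.existsUnique_isSignatureForm hn o,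
    fun Q hQ => ⟨hQ.swap, hQ.isSymm_iff⟩⟩, fun h => ?_, fun hk M _ _ _ _ _ o Q hQ =>
      hQ.isSymm_iff.2 (Or.inl hk)⟩
  obtain ⟨Q, hQ, -⟩ := DeRham.existsUnique_isSignatureForm hn (DeRham.torusOrientation n)
  exact (hQ.isSymm_iff.1 (h _ _ Q hQ)).resolve_right hQ.torus_ne_zero
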